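/- Let $G$ be a (finite-dimensional, real, smooth) Lie group with identity $e$ and Lie algebra $\mathfrak g=T_eG$ (with the bracket of left-invariant vector fields), and let $\mathcal L_a:G\to G$, $\mathcal L_a(x)=ax$. Let $L:TG\times\mathbb R\to\mathbb R$ be a smooth function that is left-invariant: $L(T\mathcal L_a(v),z)=L(v,z)$ for all $a\in G$, $v\in TG$, $z\in\mathbb R$. Let $l:\mathfrak g\times\mathbb R\to\mathbb R$ be the reduced Lagrangian, $l=L|_{T_eG\times\mathbb R}$. For $\xi\in\mathfrak g$ and $\mu\in\mathfrak g^*$ write $\langle \mathrm{ad}^*_\xi\mu,\eta\rangle=\langle\mu,[\xi,\eta]\rangle$, and let $\frac{\delta l}{\delta\xi}(\xi,z)\in\mathfrak g^*$ be the differential of $l(\cdot,z)$ at $\xi$. Let $h>0$, let $g:[0,h]\to G$ and $z:[0,h]\to\mathbb R$ be smooth curves, and put $\xi(t)=T_{g(t)}\mathcal L_{g(t)^{-1}}(\dot g(t))\in\mathfrak g$. Then the following four statements are equivalent. 1. $(g,z)$ satisfies the Herglotz equations for $L$ on $[0,h]$: $\dot z=L(g,\dot g,z)$, and in the bundle coordinates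 $(q^i,\dot q^i,z)$ induced by any smooth chart of $G$, at all times at which $g$ lies in the chart domain, $$\frac{d}{dt}\frac{\partial L}{\partial\dot q^i}=\frac{\partial L}{\partial q^i}+\frac{\partial L}{\partial\dot q^i}\frac{\partial L}{\partial z}.$$ 2. The Herglotz principle holds for variations of $g$ with fixed endpoints: $\dot z=L(g,\dot g,z)$ on $[0,h]$, and for every smooth family $c(s,t)\in G$, $|s|<\varepsilon$, $t\in[0,h]$, with $c(0,t)=g(t)$, $c(s,0)=g(0)$, $c(s,h)=g(h)$, the initial value problem $\partial_t z(s,t)=L(c,\partial_tc,z(s,t))$, $z(s,0)=z(0)$, has a solution on $[0,h]$ for all small $|s|$, and $s\mapsto\int_0^hL(c,\partial_tc,z(s,t))\,dt$ is differentiable at $s=0$ with derivative $0$. 3. $(\xi,z)$ satisfies the Euler–Poincaré–Herglotz equations on $[0,h]$: $$\frac{d}{dt}\frac{\delta l}{\delta\xi}=\mathrm{ad}^*_\xi\frac{\delta l}{\delta\xi}+\frac{\delta l}{\delta\xi}\frac{\partial l}{\partial z},\qquad \dot z=l(\xi,z).$$ 4. The reduced Herglotz principle holds: $\dot z=l(\xi,z)$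 on $[0,h]$, and for every smooth curve $\eta:[0,h]\to\mathfrak g$ with $\eta(0)=\eta(h)=0$ and every smooth family $\xi(s,t)\in\mathfrak g$, $|s|<\varepsilon$, $t\in[0,h]$, with $\xi(0,t)=\xi(t)$ and $\partial_s\xi(0,t)=\dot\eta(t)+[\xi(t),\eta(t)]$, the initial value problem $\partial_tz(s,t)=l(\xi(s,t),z(s,t))$, $z(s,0)=z(0)$, has a solution on $[0,h]$ for all small $|s|$, and $s\mapsto\int_0^hl(\xi(s,t),z(s,t))\,dt$ is differentiable at $s=0$ with derivative $0$. -/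

import Mathlib

open Set
open scoped Manifold ContDiff

noncomputable section

namespace Herglotz

variable {E : Type*} [NormedAddCommGroup E] [NormedSpace ℝ E]
  {H : Type*} [TopologicalSpace H] (I : ModelWithCorners ℝ E H)
  {G : Type*} [TopologicalSpace G] [ChartedSpace H G]

/-- The velocity lift `t ↦ (g t, ġ t)` in `TG` of a curve `g : [0, h] → G` (with one-sided
derivatives at the endpoints). -/
def velocity (h : ℝ) (g : ℝ → G) (t : ℝ) : TangentBundle I G :=
  ⟨g t, mfderivWithin 𝓘(ℝ, ℝ) I g (Icc 0 h) t (1 : ℝ)⟩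

/-- The expression of `L : TG × ℝ → ℝ` in the bundle coordinates `(q, q̇, z)` that are induced
by a chart `e` of `G`. -/
def localLagrangian (L : TangentBundle I G × ℝ → ℝ) (e : OpenPartialHomeomorph G H)
    (q v : E) (w : ℝ) : ℝ :=
  L (⟨(e.extend I).symm q, mfderiv 𝓘(ℝ, E) I (e.extend I).symm q v⟩, w)

/-- The equation `ż = L(g, ġ, z)` on `[0, h]`. -/
def ActionEquation (L : TangentBundle I G × ℝ → ℝ) (h : ℝ) (g : ℝ → G) (z : ℝ → ℝ) : Prop :=
  ∀ t ∈ Icc 0 h, HasDerivWithinAt z (L (velocity I h g t, z t)) (Icc 0 h) t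

/-- The Herglotz equations for `L` along `(g, z) : [0, h] → G × ℝ`: in the bundle coordinates of
every smooth chart of `G`,
`d/dt (∂L/∂q̇) = ∂L/∂q + (∂L/∂z) ∂L/∂q̇` as long as `g` stays in the chart, and `ż = L`. -/
def HerglotzEquations (L : TangentBundle I G × ℝ → ℝ) (h : ℝ) (g : ℝ → G) (z : ℝ → ℝ) : Prop :=
  (∀ e ∈ IsManifold.maximalAtlas I ∞ G, ∀ t ∈ Icc 0 h, g t ∈ e.source →
    let Le := localLagrangian I L e
    let q : ℝ → E := fun τ => e.extend I (g τ)
    let q' : ℝ → E := derivWithin q (Icc 0 h)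
    HasDerivWithinAt (fun τ => fderiv ℝ (fun v => Le (q τ) v (z τ)) (q' τ))
      (fderiv ℝ (fun x => Le x (q' t) (z t)) (q t)
        + deriv (fun w => Le (q t) (q' t) w) (z t) •
          fderiv ℝ (fun v => Le (q t) v (z t)) (q' t))
      (Icc 0 h) t) ∧
  ActionEquation I L h g z

/-- Stationarity at `s = 0` of the Herglotz action along a one-parameter family.
`Λ s t w` is the value of the Lagrangian at time `t` along the curve with parameter `s`, with
`z`-variable `w`. For small `s` the initial value problem
`∂Z/∂t = Λ s t Z`, `Z s 0 = z₀`, has a solution on `[0, h]`, and the action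
`s ↦ ∫₀ʰ Λ s t (Z s t) dt` is differentiable at `0` with derivative `0`. -/
def ActionStationary (h z₀ : ℝ) (Λ : ℝ → ℝ → ℝ → ℝ) : Prop :=
  ∃ δ > 0, ∃ Z : ℝ → ℝ → ℝ,
    (∀ s ∈ Ioo (-δ) δ, Z s 0 = z₀ ∧
      ∀ t ∈ Icc 0 h, HasDerivWithinAt (Z s) (Λ s t (Z s t)) (Icc 0 h) t) ∧
    HasDerivAt (fun s => ∫ t in (0 : ℝ)..h, Λ s t (Z s t)) 0 0

/-- `c s t`, `|s| < ε`, `t ∈ [0, h]`, is a smooth variation of `g` with fixed endpoints. -/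
structure IsFixedEndpointVariation (h ε : ℝ) (g : ℝ → G) (c : ℝ → ℝ → G) : Prop where
  smooth : ContMDiffOn 𝓘(ℝ, ℝ × ℝ) I ∞ (fun p : ℝ × ℝ => c p.1 p.2) (Ioo (-ε) ε ×ˢ Icc 0 h)
  base : ∀ t ∈ Icc 0 h, c 0 t = g t
  left : ∀ s ∈ Ioo (-ε) ε, c s 0 = g 0
  right : ∀ s ∈ Ioo (-ε) ε, c s h = g h

/-- The Herglotz variational principle for `L` with fixed-endpoint variations of `g`. -/
def HerglotzPrinciple (L : TangentBundle I G × ℝ → ℝ) (h : ℝ) (g : ℝ → G) (z : ℝ → ℝ) : Prop :=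
  ActionEquation I L h g z ∧
  ∀ ε > 0, ∀ c : ℝ → ℝ → G, IsFixedEndpointVariation I h ε g c →
    ActionStationary h (z 0) (fun s t w => L (velocity I h (c s) t, w))

variable [Group G]

/-- Invariance of `L` under the lifted action `(v, z) ↦ (T ℒ_a v, z)` on `TG × ℝ`. -/
def LeftInvariant (L : TangentBundle I G × ℝ → ℝ) : Prop :=
  ∀ (a : G) (v : TangentBundle I G) (w : ℝ), L (tangentMap I I (fun x => a * x) v, w) = L (v, w)

/-- The reduced Lagrangian, i.e. the restriction of `L` to `T_e G × ℝ = 𝔤 × ℝ`. -/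
def reducedLagrangian (L : TangentBundle I G × ℝ → ℝ) (x : GroupLieAlgebra I G) (w : ℝ) : ℝ :=
  L (⟨1, x⟩, w)

/-- The curve `ξ(t) = T_{g(t)} ℒ_{g(t)⁻¹} (ġ(t))` in the Lie algebra. The ascription identifies
the tangent space at `g(t)⁻¹ g(t)` with the one at `1`. -/
def bodyVelocity (h : ℝ) (g : ℝ → G) (t : ℝ) : GroupLieAlgebra I G :=
  (mfderiv I I (fun x => (g t)⁻¹ * x) (g t) (velocity I h g t).2 :
    TangentSpace I ((g t)⁻¹ * g t))

theorem lieGroup_three [LieGroup I ∞ G] : LieGroup I (minSmoothness ℝ 3) G :=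
  LieGroup.of_le (n := ∞) (by simpa using WithTop.coe_le_coe.2 (le_top : (3 : ℕ∞) ≤ ⊤))

/-- `ad*_x μ = μ ∘ ad_x`. -/
def coad [FiniteDimensional ℝ E] [LieGroup I ∞ G] (x : GroupLieAlgebra I G)
    (μ : GroupLieAlgebra I G →L[ℝ] ℝ) : GroupLieAlgebra I G →L[ℝ] ℝ :=
  haveI : LieGroup I (minSmoothness ℝ 3) G := lieGroup_three I
  haveI : CompleteSpace E := FiniteDimensional.complete ℝ E
  haveI : FiniteDimensional ℝ (GroupLieAlgebra I G) := inferInstanceAs (FiniteDimensional ℝ E)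
  haveI : T2Space (GroupLieAlgebra I G) := inferInstanceAs (T2Space E)
  LinearMap.toContinuousLinearMap
    (μ.toLinearMap ∘ₗ (LieAlgebra.ad ℝ (GroupLieAlgebra I G) x))

@[simp] theorem coad_apply [FiniteDimensional ℝ E] [LieGroup I ∞ G] (x y : GroupLieAlgebra I G)
    (μ : GroupLieAlgebra I G →L[ℝ] ℝ) : coad I x μ y = μ ⁅x, y⁆ := rfl

/-- The functional derivative `δl/δξ ∈ 𝔤*` at `(x, w)`. -/
def functionalDeriv (l : GroupLieAlgebra I G → ℝ → ℝ) (x : GroupLieAlgebra I G) (w : ℝ) :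
    GroupLieAlgebra I G →L[ℝ] ℝ :=
  fderiv ℝ (fun y => l y w) x

/-- The equation `ż = l(ξ, z)` on `[0, h]`. -/
def ReducedActionEquation (l : GroupLieAlgebra I G → ℝ → ℝ) (h : ℝ)
    (ξ : ℝ → GroupLieAlgebra I G) (z : ℝ → ℝ) : Prop :=
  ∀ t ∈ Icc 0 h, HasDerivWithinAt z (l (ξ t) (z t)) (Icc 0 h) t

/-- The Euler-Poincaré-Herglotz equations on `[0, h]`:
`d/dt δl/δξ = ad*_ξ δl/δξ + (∂l/∂z) δl/δξ` and `ż = l`. -/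
def EulerPoincareHerglotz [FiniteDimensional ℝ E] [LieGroup I ∞ G]
    (l : GroupLieAlgebra I G → ℝ → ℝ) (h : ℝ) (ξ : ℝ → GroupLieAlgebra I G) (z : ℝ → ℝ) : Prop :=
  (∀ t ∈ Icc 0 h,
    HasDerivWithinAt (fun τ => functionalDeriv I l (ξ τ) (z τ))
      (coad I (ξ t) (functionalDeriv I l (ξ t) (z t))
        + deriv (fun w => l (ξ t) w) (z t) • functionalDeriv I l (ξ t) (z t))
      (Icc 0 h) t) ∧
  ReducedActionEquation I l h ξ z

/-- `x s t`, `|s| < ε`, `t ∈ [0, h]`, is a smooth variation of `ξ` with infinitesimal variation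
`δξ = η̇ + [ξ, η]` for a smooth curve `η` in `𝔤` that vanishes at the endpoints. -/
structure IsReducedVariation (h ε : ℝ) (ξ η : ℝ → GroupLieAlgebra I G)
    (x : ℝ → ℝ → GroupLieAlgebra I G) : Prop where
  smooth_curve : ContDiffOn ℝ ∞ (F := E) η (Icc 0 h)
  left : η 0 = 0
  right : η h = 0
  smooth : ContDiffOn ℝ ∞ (F := E) (fun p : ℝ × ℝ => x p.1 p.2) (Ioo (-ε) ε ×ˢ Icc 0 h)
  base : ∀ t ∈ Icc 0 h, x 0 t = ξ t
  variation : ∀ t ∈ Icc 0 h,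
    HasDerivAt (fun s => x s t) (derivWithin η (Icc 0 h) t + ⁅ξ t, η t⁆) 0

/-- The reduced Herglotz variational principle, with variations `δξ = η̇ + [ξ, η]`. -/
def ReducedHerglotzPrinciple (l : GroupLieAlgebra I G → ℝ → ℝ) (h : ℝ)
    (ξ : ℝ → GroupLieAlgebra I G) (z : ℝ → ℝ) : Prop :=
  ReducedActionEquation I l h ξ z ∧
  ∀ ε > 0, ∀ (η : ℝ → GroupLieAlgebra I G) (x : ℝ → ℝ → GroupLieAlgebra I G),
    IsReducedVariation I h ε ξ η x →
      ActionStationary h (z 0) (fun s t w => l (x s t) w)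

end Herglotz

end

/-! Both variational principles reduce to the third statement through the Maurer-Cartan form of `G`,
realised as the left logarithmic derivative `mcForm`.

Analytic half. The action along a family equals `Z s h - z 0`, with `Z s` the solution of the
Herglotz ODE, so its derivative at `s = 0` is the final value of the solution `y` of the linearised
ODE (`IsC1Family.hasDerivAt_solution`). For `δξ = η̇ + [ξ, η]` and momentum `p = δl/δξ`, variation
of constants gives `y = p(η) + m⁻¹ ∫ m R(η)`. Here `m = exp(-∫ ∂l/∂z)` is `integratingFactor`, and
`R` is the defect `ephResidual` of the Euler-Poincaré-Herglotz equation. As `η` vanishes at both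
ends, stationarity means `∫ m R(η) = 0` over `[0, h]` (`actionStationary_iff_integral_ephResidual`).

Geometric half. The equation `maurerCartan` on the strip of parameters `(s, t)` shows that a
fixed-endpoint variation of `g` induces `δξ = η̇ + [ξ, η]` with `η = c⁻¹ ∂c/∂s`. If `R = 0`, every
reduced variation is stationary (3 → 4), and fixed-endpoint variations induce reduced ones (4 → 2).
Since every `η = f v`, with `f` a bump function and `v` a fixed vector, comes from some variation of
`g`, the fundamental lemma forces `R = 0` (2 → 3). No reduced variation has to be integrated to
curves in `G`.

Charts. With `A` the logarithmic derivative of the inverse chart, invariance gives `L(q, q̇, w) =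
l(A(q) q̇, w)`. By the Maurer-Cartan equation the Herglotz defect in the chart is `R ∘ A(q)`, and
`A(q)` is onto, so 1 ↔ 3 holds pointwise in time. -/

noncomputable section

namespace Herglotz

open Filter Topology VectorField
open scoped NNReal

/-! ### Left logarithmic derivatives. -/

section MaurerCartan

variable {E : Type*} [NormedAddCommGroup E] [NormedSpace ℝ E]
  {H : Type*} [TopologicalSpace H] (I : ModelWithCorners ℝ E H)
  {G : Type*} [TopologicalSpace G] [ChartedSpace H G] [Group G]
  {V : Type*} [NormedAddCommGroup V] [NormedSpace ℝ V]
  {W : Type*} [NormedAddCommGroup W] [NormedSpace ℝ W]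

/-- The left logarithmic derivative of `f : V → G` within `S`, i.e. the pullback of the
Maurer-Cartan form of `G` under `f`. -/
def mcForm (f : V → G) (S : Set V) (p : V) : V →L[ℝ] E :=
  fderivWithin ℝ (fun y => extChartAt I (1 : G) ((f p)⁻¹ * f y)) S p

variable {I}

theorem mcForm_congr {f f' : V → G} {S : Set V} {p : V} (h : f =ᶠ[𝓝[S] p] f') (hp : f p = f' p) :
    mcForm I f S p = mcForm I f' S p := by
  unfold mcForm
  rw [hp]
  refine Filter.EventuallyEq.fderivWithin_eq ?_ (by simp [hp])
  filter_upwards [h] with y hy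
  rw [hy]

theorem mcForm_const_mul (a : G) (f : V → G) (S : Set V) (p : V) :
    mcForm I (fun y => a * f y) S p = mcForm I f S p := by
  unfold mcForm
  congr 1
  ext y
  congr 1
  group

variable [LieGroup I ∞ G]

theorem contMDiffWithinAt_logChart {f : V → G} {S : Set V} {p : V}
    (hf : ContMDiffWithinAt 𝓘(ℝ, V) I ∞ f S p) (a : G) (ha : a * f p = 1) :
    ContDiffWithinAt ℝ ∞ (fun y => extChartAt I (1 : G) (a * f y)) S p := by
  rw [← contMDiffWithinAt_iff_contDiffWithinAt]
  have h1 : ContMDiffWithinAt 𝓘(ℝ, V) I ∞ (fun y => a * f y) S p :=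
    contMDiffWithinAt_const.mul hf
  have h2 : ContMDiffAt I 𝓘(ℝ, E) ∞ (extChartAt I (1 : G)) (a * f p) := by
    rw [ha]; exact contMDiffAt_extChartAt
  exact h2.comp_contMDiffWithinAt p h1

theorem contDiffWithinAt_logChart₂ {f : V → G} {S : Set V} {p : V}
    (hf : ContMDiffWithinAt 𝓘(ℝ, V) I ∞ f S p) :
    ContDiffWithinAt ℝ ∞ (Function.uncurry fun x y => extChartAt I (1 : G) ((f x)⁻¹ * f y))
      (S ×ˢ S) (p, p) := by
  rw [← contMDiffWithinAt_iff_contDiffWithinAt]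
  have hx : ContMDiffWithinAt 𝓘(ℝ, V × V) I ∞ (fun q : V × V => f q.1) (S ×ˢ S) (p, p) :=
    ContMDiffWithinAt.comp (I' := 𝓘(ℝ, V)) (t := S) (p, p) hf
      contDiffWithinAt_fst.contMDiffWithinAt (fun q hq => hq.1)
  have hy : ContMDiffWithinAt 𝓘(ℝ, V × V) I ∞ (fun q : V × V => f q.2) (S ×ˢ S) (p, p) :=
    ContMDiffWithinAt.comp (I' := 𝓘(ℝ, V)) (t := S) (p, p) hf
      contDiffWithinAt_snd.contMDiffWithinAt (fun q hq => hq.2)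
  have h2 : ContMDiffAt I 𝓘(ℝ, E) ∞ (extChartAt I (1 : G)) ((f p)⁻¹ * f p) := by
    rw [inv_mul_cancel]; exact contMDiffAt_extChartAt
  exact h2.comp_contMDiffWithinAt (p, p) (hx.inv.mul hy)

theorem contDiffOn_mcForm {f : V → G} {S : Set V} (hf : ContMDiffOn 𝓘(ℝ, V) I ∞ f S)
    (hS : UniqueDiffOn ℝ S) : ContDiffOn ℝ ∞ (mcForm I f S) S := fun p hp =>
  (contDiffWithinAt_logChart₂ (hf p hp)).fderivWithin contDiffWithinAt_id hS (by simp) hp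
    subset_rfl

/-- The chain rule for left logarithmic derivatives. -/
theorem mcForm_comp {f : V → G} {S : Set V} {k : W → V} {S' : Set W} {p : W}
    (hf : ContMDiffWithinAt 𝓘(ℝ, V) I ∞ f S (k p))
    (hk : DifferentiableWithinAt ℝ k S' p) (hS' : UniqueDiffWithinAt ℝ S' p)
    (hkS : Tendsto k (𝓝[S'] p) (𝓝[S] (k p))) :
    mcForm I (fun y => f (k y)) S' p = (mcForm I f S (k p)).comp (fderivWithin ℝ k S' p) := by
  have h1 := (contMDiffWithinAt_logChart hf _ (inv_mul_cancel (f (k p)))).differentiableWithinAt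
    (by simp)
  exact (HasFDerivWithinAt.comp_of_tendsto p h1.hasFDerivWithinAt hk.hasFDerivWithinAt
    hkS).fderivWithin hS'

theorem mcForm_eq_mfderiv {f : V → G} {S : Set V} {p : V}
    (hf : ContMDiffWithinAt 𝓘(ℝ, V) I ∞ f S p) (hS : UniqueDiffWithinAt ℝ S p) (v : V) :
    mcForm I f S p v = (mfderiv I I (fun x => (f p)⁻¹ * x) (f p)
      (mfderivWithin 𝓘(ℝ, V) I f S p v) : TangentSpace I ((f p)⁻¹ * f p)) := by
  have hfd := hf.mdifferentiableWithinAt (by simp)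
  have hm : MDifferentiableAt I I (fun x => (f p)⁻¹ * x) (f p) :=
    (contMDiff_mul_left (n := ∞)).contMDiffAt.mdifferentiableAt (by simp)
  have hc := mfderiv_comp_mfderivWithin p hm hfd hS.uniqueMDiffWithinAt
  have hd : MDifferentiableWithinAt 𝓘(ℝ, V) I ((fun x => (f p)⁻¹ * x) ∘ f) S p :=
    hm.comp_mdifferentiableWithinAt p hfd
  -- The translated map sends `p` to `1`, so the chart in which `mfderivWithin` reads it is the one
  -- used by `mcForm`.
  have h3 : (mfderivWithin 𝓘(ℝ, V) I ((fun x => (f p)⁻¹ * x) ∘ f) S p : V →L[ℝ] E)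
      = mcForm I f S p := by
    refine (if_pos hd).trans ?_
    unfold mcForm writtenInExtChartAt
    simp only [Function.comp_apply, inv_mul_cancel]
    simp [Function.comp_def]
    rfl
  rw [← h3, hc]
  rfl

theorem bodyVelocity_eq_mcForm {h : ℝ} (hh : 0 < h) {g : ℝ → G} {t : ℝ} (ht : t ∈ Icc 0 h)
    (hg : ContMDiffWithinAt 𝓘(ℝ, ℝ) I ∞ g (Icc 0 h) t) :
    bodyVelocity I h g t = (mcForm I g (Icc 0 h) t (1 : ℝ) : E) :=
  (mcForm_eq_mfderiv hg (uniqueDiffOn_Icc hh t ht) 1).symm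

end MaurerCartan

/-! ### The Maurer-Cartan equation. -/

section MaurerCartanEquation

variable {E : Type*} [NormedAddCommGroup E] [NormedSpace ℝ E]
  {H : Type*} [TopologicalSpace H] {I : ModelWithCorners ℝ E H}
  {G : Type*} [TopologicalSpace G] [ChartedSpace H G] [Group G]
  {V : Type*} [NormedAddCommGroup V] [NormedSpace ℝ V]

theorem extChartAt_one_symm_self : (extChartAt I (1 : G)).symm (extChartAt I (1 : G) 1) = 1 :=
  extChartAt_to_inv 1

theorem extChartAt_one_target_mem_nhds [I.Boundaryless] :
    (extChartAt I (1 : G)).target ∈ 𝓝 (extChartAt I (1 : G) 1) :=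
  (isOpen_extChartAt_target (1 : G)).mem_nhds (mem_extChartAt_target 1)

variable [LieGroup I ∞ G]

theorem contMDiffOn_extChartAt_one_symm :
    ContMDiffOn 𝓘(ℝ, E) I ∞ (extChartAt I (1 : G)).symm (extChartAt I (1 : G)).target :=
  contMDiffOn_extChartAt_symm 1

theorem mfderiv_mul_left_inv_mulInvariantVectorField (g : G) (v : GroupLieAlgebra I G) :
    (mfderiv I I (fun x => g⁻¹ * x) g (mulInvariantVectorField v g) : E)
      = v := by
  have hm (a b : G) : MDifferentiableAt I I (fun x => a * x) b :=
    (contMDiff_mul_left (n := ∞)).contMDiffAt.mdifferentiableAt (by simp)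
  have h1 : mfderiv I I ((fun x => g⁻¹ * x) ∘ fun x => g * x) (1 : G)
      = (mfderiv I I (fun x => g⁻¹ * x) (g * 1)).comp (mfderiv I I (fun x => g * x) (1 : G)) :=
    mfderiv_comp 1 (hm _ _) (hm _ _)
  have h2 : ((fun x => g⁻¹ * x) ∘ fun x => g * x) = (id : G → G) := by
    ext x; simp
  rw [h2, mfderiv_id] at h1
  have h3 := congrArg (fun T : E →L[ℝ] E => T v) h1
  rw [mul_one] at h3
  exact h3.symm

variable [I.Boundaryless]

theorem mcForm_extChartAt_symm_one :
    mcForm I (extChartAt I (1 : G)).symm (extChartAt I (1 : G)).target (extChartAt I (1 : G) 1)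
      = ContinuousLinearMap.id ℝ E := by
  have hu : UniqueDiffWithinAt ℝ (extChartAt I (1 : G)).target (extChartAt I (1 : G) 1) :=
    (isOpen_extChartAt_target (1 : G)).uniqueDiffWithinAt (mem_extChartAt_target 1)
  rw [← fderivWithin_id hu]
  refine Filter.EventuallyEq.fderivWithin_eq_of_mem ?_ (mem_extChartAt_target 1)
  filter_upwards [self_mem_nhdsWithin] with y hy
  rw [extChartAt_one_symm_self, inv_one, one_mul, (extChartAt I (1 : G)).right_inv hy, id]

variable (I) in
/-- The expression in the chart at `1` of the left-invariant vector field that extends `v`. -/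
def chartInvField (G : Type*) [TopologicalSpace G] [ChartedSpace H G] [Group G]
    (v : GroupLieAlgebra I G) (x : E) : E :=
  mpullbackWithin 𝓘(ℝ, E) I (extChartAt I (1 : G)).symm
    (mulInvariantVectorField v) (range I) x

variable (I G) in
/-- The bracket of the Lie algebra of `G`, on the model space `E`. -/
def algBracket (v w : E) : E :=
  Bracket.bracket (L := GroupLieAlgebra I G) (M := GroupLieAlgebra I G) v w

/-- The inverse derivative in the pullback cancels against the derivative of the inverse chart,
leaving an invariant field translated back to `1`. This constancy is what gets differentiated to
obtain the structure equation. -/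
theorem mcForm_chartInvField (v : GroupLieAlgebra I G) {x : E}
    (hx : x ∈ (extChartAt I (1 : G)).target) :
    mcForm I (extChartAt I (1 : G)).symm (extChartAt I (1 : G)).target x
      (chartInvField I G v x) = v := by
  have ho := isOpen_extChartAt_target (I := I) (1 : G)
  have hinv := isInvertible_mfderivWithin_extChartAt_symm hx
  have h1 : mfderivWithin 𝓘(ℝ, E) I (extChartAt I (1 : G)).symm (extChartAt I (1 : G)).target x
      = mfderivWithin 𝓘(ℝ, E) I (extChartAt I (1 : G)).symm (range I) x := by
    rw [mfderivWithin_of_mem_nhds (ho.mem_nhds hx), I.range_eq_univ, mfderivWithin_univ]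
  have h2 : (mfderivWithin 𝓘(ℝ, E) I (extChartAt I (1 : G)).symm (extChartAt I (1 : G)).target x :
      E →L[ℝ] E) (chartInvField I G v x : E)
      = mulInvariantVectorField v ((extChartAt I (1 : G)).symm x) := by
    rw [h1]
    exact hinv.self_apply_inverse _
  refine (mcForm_eq_mfderiv (contMDiffOn_extChartAt_one_symm x hx)
    (ho.uniqueDiffWithinAt hx) _).trans ((congrArg (mfderiv I I (fun y =>
      ((extChartAt I (1 : G)).symm x)⁻¹ * y) ((extChartAt I (1 : G)).symm x)) h2).trans ?_)
  exact mfderiv_mul_left_inv_mulInvariantVectorField _ v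

theorem differentiableAt_chartInvField [CompleteSpace E] (v : GroupLieAlgebra I G) :
    DifferentiableAt ℝ (chartInvField I G v) (extChartAt I (1 : G) 1) := by
  have : LieGroup I (minSmoothness ℝ 3) G := lieGroup_three I
  have : IsManifold I 2 G := IsManifold.of_le (n := ∞) (by norm_cast)
  have := MDifferentiableWithinAt.differentiableWithinAt_mpullbackWithin_vectorField
    (mdifferentiableAt_mulInvariantVectorField (I := I) v (g := (1 : G))).mdifferentiableWithinAt
      (s := univ)
  change DifferentiableWithinAt ℝ (chartInvField I G v) _ _ at this
  rwa [preimage_univ, univ_inter, I.range_eq_univ, differentiableWithinAt_univ] at this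

/-- The manifold bracket is computed by pulling back to a chart, and the chart at `1` has identity
derivative at `1`. -/
theorem algBracket_eq_lieBracket (v w : GroupLieAlgebra I G) :
    algBracket I G v w
      = lieBracket ℝ (chartInvField I G v) (chartInvField I G w) (extChartAt I (1 : G) 1) := by
  change mlieBracketWithin I (mulInvariantVectorField v) (mulInvariantVectorField w) univ 1 = _
  have h1 : (mfderiv I 𝓘(ℝ, E) (extChartAt I (1 : G)) 1 : E →L[ℝ] E)
      = ContinuousLinearMap.id ℝ E := mfderiv_extChartAt_self
  rw [mlieBracketWithin_apply, preimage_univ, univ_inter]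
  refine (congrArg (fun T : E →L[ℝ] E => T.inverse (lieBracketWithin ℝ (chartInvField I G v)
    (chartInvField I G w) (range I) (extChartAt I (1 : G) 1))) h1).trans ?_
  rw [ContinuousLinearMap.inverse_id, ContinuousLinearMap.id_apply, I.range_eq_univ,
    lieBracketWithin_univ]

/-- Differentiating `A(x) X_v(x) = v` at the base point `o`, where `A = id`, gives `DX_v(o) w =
-DA(o) w v`. Substitution into the Lie bracket of `X_v` and `X_u` yields the formula. -/
theorem fderiv_mcForm_extChartAt_symm_one [CompleteSpace E] (u v : E) :
    let A := mcForm I (extChartAt I (1 : G)).symm (extChartAt I (1 : G)).target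
    fderiv ℝ A (extChartAt I (1 : G) 1) u v - fderiv ℝ A (extChartAt I (1 : G) 1) v u
      = algBracket I G v u := by
  intro A
  set o := extChartAt I (1 : G) 1 with ho
  have hA : DifferentiableAt ℝ A o :=
    ((contDiffOn_mcForm contMDiffOn_extChartAt_one_symm
      (isOpen_extChartAt_target (1 : G)).uniqueDiffOn).contDiffAt
        extChartAt_one_target_mem_nhds).differentiableAt (by simp)
  have hAo : A o = ContinuousLinearMap.id ℝ E := mcForm_extChartAt_symm_one
  have hXo (v : GroupLieAlgebra I G) : chartInvField I G v o = v := by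
    have := mcForm_chartInvField (I := I) (G := G) v (mem_extChartAt_target 1)
    change A o _ = v at this
    rwa [hAo] at this
  have hd (v : GroupLieAlgebra I G) (w : E) :
      fderiv ℝ (chartInvField I G v) o w = - fderiv ℝ A o w v := by
    have h1 := (hA.hasFDerivAt.clm_apply
      (differentiableAt_chartInvField (I := I) (G := G) v).hasFDerivAt)
    have h2 : (fun x => A x (chartInvField I G v x)) =ᶠ[𝓝 o] fun _ => v := by
      filter_upwards [extChartAt_one_target_mem_nhds (I := I) (G := G)] with x hx
      exact mcForm_chartInvField v hx
    have h3 := h1.unique ((hasFDerivAt_const v o).congr_of_eventuallyEq h2)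
    have h4 := congrArg (fun T : E →L[ℝ] E => T w) h3
    rw [hAo, hXo] at h4
    exact eq_neg_of_add_eq_zero_left h4
  refine Eq.trans ?_ (algBracket_eq_lieBracket v u).symm
  unfold lieBracket
  rw [← ho, hXo v, hXo u, hd v, hd u]
  abel

/-- The Maurer-Cartan equation. -/
theorem maurerCartan [CompleteSpace E] {f : V → G} {S : Set V}
    (hf : ContMDiffOn 𝓘(ℝ, V) I ∞ f S) (hS : UniqueDiffOn ℝ S) {p : V} (hp : p ∈ S)
    (hpS : p ∈ closure (interior S)) (u v : V) :
    fderivWithin ℝ (mcForm I f S) S p u v - fderivWithin ℝ (mcForm I f S) S p v u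
      = algBracket I G (mcForm I f S p v) (mcForm I f S p u) := by
  set T := (extChartAt I (1 : G)).target with hT
  set A := mcForm I (extChartAt I (1 : G)).symm T with hA
  set k : V → E := fun y => extChartAt I (1 : G) ((f p)⁻¹ * f y) with hk
  have hTo : IsOpen T := isOpen_extChartAt_target (1 : G)
  have hkp : k p = extChartAt I (1 : G) 1 := by simp only [hk, inv_mul_cancel]
  have hsrc : ∀ᶠ y in 𝓝[S] p, (f p)⁻¹ * f y ∈ (extChartAt I (1 : G)).source := by
    have hc : ContinuousWithinAt (fun y => (f p)⁻¹ * f y) S p :=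
      (contMDiff_mul_left (I := I) (n := ∞) (a := (f p)⁻¹)).continuous.continuousAt
        |>.comp_continuousWithinAt (hf p hp).continuousWithinAt
    refine hc.eventually_mem ((isOpen_extChartAt_source (1 : G)).mem_nhds ?_)
    simp only [inv_mul_cancel]
    exact mem_extChartAt_source 1
  have hkc : ContDiffWithinAt ℝ ∞ k S p := contMDiffWithinAt_logChart (hf p hp) _ (inv_mul_cancel _)
  have hkc' : ∀ᶠ y in 𝓝[S] p, ContDiffWithinAt ℝ 2 k S y := by
    have := (hkc.of_le (m := 2) (by norm_cast)).eventually (by simp)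
    rwa [insert_eq_of_mem hp] at this
  -- After translation by `(f p)⁻¹`, `f` factors through the chart at `1`. Differentiating this
  -- product leaves the chart term at `1` plus a second derivative of `k`, which is symmetric and
  -- cancels.
  have hω : mcForm I f S =ᶠ[𝓝[S] p] fun y => (A (k y)).comp (fderivWithin ℝ k S y) := by
    filter_upwards [eventually_eventually_nhdsWithin.2 hsrc, hkc', self_mem_nhdsWithin]
      with y hy hky hyS
    have hy0 : k y ∈ T := (extChartAt I (1 : G)).map_source (hy.self_of_nhdsWithin hyS)
    rw [← mcForm_const_mul (f p)⁻¹ f, ← mcForm_comp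
      (contMDiffOn_extChartAt_one_symm (k y) hy0) (hky.differentiableWithinAt (by simp))
      (hS y hyS)]
    · refine mcForm_congr ?_ ?_
      · filter_upwards [hy] with x hx
        exact ((extChartAt I (1 : G)).left_inv hx).symm
      · exact ((extChartAt I (1 : G)).left_inv (hy.self_of_nhdsWithin hyS)).symm
    · rw [hTo.nhdsWithin_eq hy0]
      exact hky.continuousWithinAt
  have hAd : DifferentiableAt ℝ A (k p) := by
    rw [hkp]
    exact ((contDiffOn_mcForm contMDiffOn_extChartAt_one_symm hTo.uniqueDiffOn).contDiffAt
      extChartAt_one_target_mem_nhds).differentiableAt (by simp)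
  have hDk : DifferentiableWithinAt ℝ (fderivWithin ℝ k S) S p :=
    (hkc.fderivWithin_right (m := 1) hS (by norm_cast) hp).differentiableWithinAt (by simp)
  have hd := (hAd.hasFDerivAt.comp_hasFDerivWithinAt p
    (hkc.differentiableWithinAt (by simp)).hasFDerivWithinAt).clm_comp hDk.hasFDerivWithinAt
  have hd' := (hd.congr_of_eventuallyEq hω (hω.self_of_nhdsWithin hp)).fderivWithin (hS p hp)
  -- At a boundary point of `S`, symmetry rests on `p` being a limit of interior points.
  have hsymm : IsSymmSndFDerivWithinAt ℝ k S p :=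
    hkc.isSymmSndFDerivWithinAt (by simp; norm_cast) hS hpS hp
  have hMC := fderiv_mcForm_extChartAt_symm_one (I := I) (G := G)
    (fderivWithin ℝ k S p u) (fderivWithin ℝ k S p v)
  have hωp : mcForm I f S p = fderivWithin ℝ k S p := rfl
  rw [hd', hωp, ← hMC, ← hT, ← hA, ← hkp]
  have hAo : A (k p) = ContinuousLinearMap.id ℝ E := by
    rw [hkp]; exact mcForm_extChartAt_symm_one
  have := hsymm.eq u v
  simp [hAo, this]

end MaurerCartanEquation

/-! ### Existence and parameter differentiation for scalar ODEs. -/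

section ScalarODE

/-- `F s t w` is a family of time-dependent vector fields on `ℝ`, which is `C¹` in `(s, w)` with
derivative `D s t w`, for `|s| < ε` and `t ∈ [0, h]`. -/
structure IsC1Family (h ε : ℝ) (F : ℝ → ℝ → ℝ → ℝ) (D : ℝ → ℝ → ℝ → ℝ × ℝ →L[ℝ] ℝ) : Prop where
  hasFDerivAt : ∀ s ∈ Ioo (-ε) ε, ∀ t ∈ Icc 0 h, ∀ w,
    HasFDerivAt (fun p : ℝ × ℝ => F p.1 t p.2) (D s t w) (s, w)
  continuousOn : ContinuousOn (fun q : ℝ × ℝ × ℝ => F q.1 q.2.1 q.2.2)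
    (Ioo (-ε) ε ×ˢ Icc 0 h ×ˢ univ)
  continuousOn_deriv : ContinuousOn (fun q : ℝ × ℝ × ℝ => D q.1 q.2.1 q.2.2)
    (Ioo (-ε) ε ×ˢ Icc 0 h ×ˢ univ)

/-- `α` solves `α' = f t α` on `[0, h]`. -/
def Solves (h : ℝ) (f : ℝ → ℝ → ℝ) (α : ℝ → ℝ) : Prop :=
  ∀ t ∈ Icc 0 h, HasDerivWithinAt α (f t (α t)) (Icc 0 h) t

variable {h ε : ℝ} {F : ℝ → ℝ → ℝ → ℝ} {D : ℝ → ℝ → ℝ → ℝ × ℝ →L[ℝ] ℝ} {z y : ℝ → ℝ}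

theorem Solves.continuousOn {f : ℝ → ℝ → ℝ} {α : ℝ → ℝ} (hα : Solves h f α) :
    ContinuousOn α (Icc 0 h) := fun t ht => (hα t ht).continuousWithinAt

theorem _root_.HasDerivWithinAt.Ici_of_Icc_zero {α : ℝ → ℝ} {a t : ℝ}
    (hα : HasDerivWithinAt α a (Icc 0 h) t) (ht : t ∈ Ico 0 h) : HasDerivWithinAt α a (Ici t) t :=
  hα.mono_of_mem_nhdsWithin (Icc_mem_nhdsGE_of_mem ht)

theorem exists_abs_le_of_continuousOn {α : ℝ → ℝ} (hα : ContinuousOn α (Icc 0 h)) :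
    ∃ M, ∀ t ∈ Icc 0 h, |α t| ≤ M :=
  isCompact_Icc.exists_bound_of_continuousOn hα

theorem gronwallBound_zero_eq_mul (K e x : ℝ) :
    gronwallBound 0 K e x = e * gronwallBound 0 K 1 x := by
  unfold gronwallBound
  split_ifs <;> ring

namespace IsC1Family

/-- The derivative is bounded on a compact convex box. Working jointly in `(s, w)` lets the same
constant control the change of the field with the parameter. -/
theorem exists_lipschitzOnWith (hF : IsC1Family h ε F D) {r : ℝ} (hr : r < ε) (M : ℝ) :
    ∃ K : ℝ≥0, ∀ t ∈ Icc 0 h,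
      LipschitzOnWith K (fun p : ℝ × ℝ => F p.1 t p.2) (Icc (-r) r ×ˢ Icc (-M) M) := by
  have hsub : Icc (-r) r ⊆ Ioo (-ε) ε := Icc_subset_Ioo (by linarith) hr
  obtain ⟨C, hC⟩ :=
    (isCompact_Icc.prod (isCompact_Icc.prod isCompact_Icc)).exists_bound_of_continuousOn (hF.continuousOn_deriv.mono (prod_mono hsub (prod_mono_right (subset_univ (Icc (-M) M)))))
  refine ⟨C.toNNReal, fun t ht => ?_⟩
  refine Convex.lipschitzOnWith_of_nnnorm_hasFDerivWithin_le
    (f' := fun p => D p.1 t p.2)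
    (fun p hp => (hF.hasFDerivAt p.1 (hsub hp.1) t ht p.2).hasFDerivWithinAt)
    (fun p hp => ?_) ((convex_Icc _ _).prod (convex_Icc _ _))
  rw [← NNReal.coe_le_coe, coe_nnnorm]
  exact (hC (p.1, t, p.2) ⟨hp.1, ht, hp.2⟩).trans (Real.le_coe_toNNReal C)

theorem lipschitzOnWith_right {K : ℝ≥0} {r M t s : ℝ}
    (hK : LipschitzOnWith K (fun p : ℝ × ℝ => F p.1 t p.2) (Icc (-r) r ×ˢ Icc (-M) M))
    (hs : s ∈ Icc (-r) r) : LipschitzOnWith K (F s t) (Icc (-M) M) := by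
  have := hK.comp (f := fun w : ℝ => (s, w)) (s := Icc (-M) M)
    (LipschitzWith.prodMk_left s).lipschitzOnWith (fun w hw => ⟨hs, hw⟩)
  simpa using! this

/-- Solutions of the initial value problems are unique. -/
theorem eqOn_of_solves (hF : IsC1Family h ε F D) {s : ℝ} (hs : s ∈ Ioo (-ε) ε) {α β : ℝ → ℝ}
    (hα : Solves h (F s) α) (hβ : Solves h (F s) β) (h0 : α 0 = β 0) : EqOn α β (Icc 0 h) := by
  obtain ⟨M₁, hM₁⟩ := exists_abs_le_of_continuousOn hα.continuousOn
  obtain ⟨M₂, hM₂⟩ := exists_abs_le_of_continuousOn hβ.continuousOn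
  obtain ⟨K, hK⟩ := hF.exists_lipschitzOnWith (abs_lt.2 hs) (max M₁ M₂)
  refine ODE_solution_unique_of_mem_Icc_right (v := F s) (K := K)
    (s := fun _ => Icc (-max M₁ M₂) (max M₁ M₂))
    (fun t ht => lipschitzOnWith_right (hK t (Ico_subset_Icc_self ht)) (abs_le.1 le_rfl))
    hα.continuousOn (fun t ht => (hα t (Ico_subset_Icc_self ht)).Ici_of_Icc_zero ht)
    (fun t ht => abs_le.1 ((hM₁ t (Ico_subset_Icc_self ht)).trans (le_max_left _ _)))
    hβ.continuousOn (fun t ht => (hβ t (Ico_subset_Icc_self ht)).Ici_of_Icc_zero ht)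
    (fun t ht => abs_le.1 ((hM₂ t (Ico_subset_Icc_self ht)).trans (le_max_right _ _))) h0

/-- For small parameters the initial value problems have solutions on `[0, h]`, close to a given
solution for the parameter `0`. -/
theorem exists_solves (hF : IsC1Family h ε F D) (hh : 0 < h) (hε : 0 < ε) (hz : Solves h (F 0) z)
    {M : ℝ} (hM : ∀ t ∈ Icc 0 h, |z t| + 1 ≤ M) :
    ∃ δ > 0, ∀ s ∈ Ioo (-δ) δ, ∃ α : ℝ → ℝ, α 0 = z 0 ∧ Solves h (F s) α ∧
      ∀ t ∈ Icc 0 h, |α t| ≤ M := by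
  have h0 : (0 : ℝ) ∈ Icc 0 h := ⟨le_rfl, hh.le⟩
  have hM0 : 0 < M := by have := hM 0 h0; have := abs_nonneg (z 0); linarith
  obtain ⟨K, hK⟩ := hF.exists_lipschitzOnWith (half_lt_self hε) M
  have hsub : Icc (-(ε / 2)) (ε / 2) ⊆ Ioo (-ε) ε := Icc_subset_Ioo (by linarith) (by linarith)
  obtain ⟨C, hC⟩ :=
    (isCompact_Icc.prod (isCompact_Icc.prod isCompact_Icc)).exists_bound_of_continuousOn (hF.continuousOn.mono (prod_mono hsub (prod_mono_right (subset_univ (Icc (-M) M)))))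
  -- Clamping `w` to `[-M, M]` makes the field bounded and globally Lipschitz, so solutions exist on
  -- all of `[0, h]`; the clamp is removed at the end.
  set c : ℝ → ℝ := fun w => max (-M) (min w M) with hc
  have hcm (w : ℝ) : c w ∈ Icc (-M) M :=
    ⟨le_max_left _ _, max_le (by linarith) (min_le_right _ _)⟩
  have hcl : LipschitzWith 1 c := (LipschitzWith.id.min_const M).const_max (-M)
  have hce {w : ℝ} (hw : |w| ≤ M) : c w = w := by
    rw [abs_le] at hw
    simp [hc, hw.1, hw.2]
  have hl (s : ℝ) (hs : s ∈ Icc (-(ε / 2)) (ε / 2)) (t : ℝ) (ht : t ∈ Icc 0 h) :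
      LipschitzWith K (fun w => F s t (c w)) := by
    rw [← lipschitzOnWith_univ]
    have := (lipschitzOnWith_right (hK t ht) hs).comp (f := c) (s := univ)
      hcl.lipschitzOnWith (fun w _ => hcm w)
    simpa using! this
  have hgr : Tendsto (fun s : ℝ => gronwallBound 0 K (0 + K * |s|) h) (𝓝 0) (𝓝 0) := by
    have : Continuous fun s : ℝ => gronwallBound 0 K (0 + K * |s|) h :=
      (gronwallBound_continuous_ε 0 K h).comp (by fun_prop)
    simpa [gronwallBound_ε0_δ0] using this.tendsto 0
  obtain ⟨δ, hδ, hδ'⟩ := Metric.eventually_nhds_iff.1 (hgr.eventually (gt_mem_nhds one_pos))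
  refine ⟨min δ (ε / 2), by positivity, fun s hs => ?_⟩
  have hs' : |s| < min δ (ε / 2) := abs_lt.2 hs
  have hs2 : s ∈ Icc (-(ε / 2)) (ε / 2) := abs_le.1 (hs'.le.trans (min_le_right _ _))
  have h02 : (0 : ℝ) ∈ Icc (-(ε / 2)) (ε / 2) := ⟨by linarith, by linarith⟩
  have hCt (t : ℝ) (ht : t ∈ Icc 0 h) (w : ℝ) : ‖F s t (c w)‖ ≤ C :=
    hC (s, t, c w) ⟨hs2, ht, hcm w⟩
  have hC0 : 0 ≤ C := (norm_nonneg _).trans (hCt 0 h0 0)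
  have hPL : IsPicardLindelof (fun t w => F s t (c w)) (⟨0, h0⟩ : Icc 0 h) (z 0)
      (C.toNNReal * h.toNNReal) 0 C.toNNReal K :=
    { lipschitzOnWith := fun t ht => (hl s hs2 t ht).lipschitzOnWith
      continuousOn := fun w _ => hF.continuousOn.comp (f := fun t : ℝ => (s, t, c w))
        (by fun_prop) (fun t ht => ⟨hsub hs2, ht, mem_univ _⟩)
      norm_le := fun t ht w _ => (hCt t ht w).trans (Real.le_coe_toNNReal C)
      mul_max_le := by simp [hh.le] }
  obtain ⟨α, hα0, hα⟩ := hPL.exists_eq_forall_mem_Icc_hasDerivWithinAt₀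
  have hαc : ContinuousOn α (Icc 0 h) := fun t ht => (hα t ht).continuousWithinAt
  -- Grönwall against `z`, whose defect for the parameter `s` is at most `K * |s|`: the solution
  -- stays within distance `1` of `z`, where the clamp is inactive.
  have hdist : ∀ t ∈ Icc 0 h, |α t| ≤ M := by
    intro t ht
    have h1 := dist_le_of_approx_trajectories_ODE_of_mem (v := fun t w => F s t (c w)) (K := K)
      (s := fun _ => univ) (f := α) (g := z) (a := 0) (b := h) (εf := 0) (εg := K * |s|) (δ := 0)
      (fun t ht => (hl s hs2 t (Ico_subset_Icc_self ht)).lipschitzOnWith) hαc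
      (fun t ht => (hα t (Ico_subset_Icc_self ht)).Ici_of_Icc_zero ht)
      (fun t _ => by simp) (fun _ _ => mem_univ _) hz.continuousOn
      (fun t ht => (hz t (Ico_subset_Icc_self ht)).Ici_of_Icc_zero ht)
      (fun t ht => by
        have ht' := Ico_subset_Icc_self ht
        have hzt : |z t| ≤ M := by have := hM t ht'; linarith
        have := (hK t ht').dist_le_mul (0, z t) ⟨h02, abs_le.1 hzt⟩ (s, z t) ⟨hs2, abs_le.1 hzt⟩
        simp only [hce hzt]
        simpa [Prod.dist_eq] using this) (fun _ _ => mem_univ _) (by simp [hα0]) t ht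
    have h2 : gronwallBound 0 K (0 + K * |s|) (t - 0) ≤ gronwallBound 0 K (0 + K * |s|) h :=
      gronwallBound_mono le_rfl (by positivity) K.2 (by simpa using ht.2)
    have h3 := hδ' (y := s) (by simpa using hs'.trans_le (min_le_left _ _))
    have h4 := hM t ht
    have h5 : |α t - z t| ≤ 1 := by
      rw [← Real.dist_eq]; linarith
    have h6 := abs_sub_abs_le_abs_sub (α t) (z t)
    linarith
  refine ⟨α, hα0, fun t ht => ?_, hdist⟩
  have := hα t ht
  rwa [hce (hdist t ht)] at this

/-- Uniformity in `t` comes from uniform continuity on a compact set of the derivative of `σ ↦ F σ t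
(z t + σ * y t)`, via the mean value inequality. It bounds the defect of the approximate solution `z
+ s y`. -/
theorem exists_taylor_bound (hF : IsC1Family h ε F D) (hε : 0 < ε)
    (hz : ContinuousOn z (Icc 0 h)) (hy : ContinuousOn y (Icc 0 h)) {η : ℝ} (hη : 0 < η) :
    ∃ δ > 0, ∀ s ∈ Ioo (-δ) δ, ∀ t ∈ Icc 0 h,
      |F s t (z t + s * y t) - F 0 t (z t) - s * D 0 t (z t) (1, y t)| ≤ η * |s| := by
  set Ψ : ℝ × ℝ → ℝ := fun p => D p.1 p.2 (z p.2 + p.1 * y p.2) (1, y p.2) with hΨ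
  have hsub : Icc (-(ε / 2)) (ε / 2) ⊆ Ioo (-ε) ε := Icc_subset_Ioo (by linarith) (by linarith)
  have hmap : MapsTo Prod.snd (Icc (-(ε / 2)) (ε / 2) ×ˢ Icc 0 h) (Icc 0 h) := fun p hp => hp.2
  have hz' := hz.comp continuousOn_snd hmap
  have hy' := hy.comp continuousOn_snd hmap
  have hΨc : ContinuousOn Ψ (Icc (-(ε / 2)) (ε / 2) ×ˢ Icc 0 h) := by
    refine ContinuousOn.clm_apply ?_ (continuousOn_const.prodMk hy')
    exact hF.continuousOn_deriv.comp
      (continuousOn_fst.prodMk (continuousOn_snd.prodMk (hz'.add (continuousOn_fst.mul hy'))))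
      (fun p hp => ⟨hsub hp.1, hp.2, mem_univ _⟩)
  have hu := (isCompact_Icc.prod isCompact_Icc).uniformContinuousOn_of_continuous hΨc
  obtain ⟨δ, hδ, hδ'⟩ := Metric.uniformContinuousOn_iff.1 hu η hη
  refine ⟨min δ (ε / 2), by positivity, fun s hs t ht => ?_⟩
  have hs' : |s| < min δ (ε / 2) := abs_lt.2 hs
  have hσ (σ : ℝ) (h : σ ∈ uIcc 0 s) : |σ| ≤ |s| := by
    have := abs_sub_left_of_mem_uIcc h
    simpa using this
  have hmem {σ : ℝ} (h : |σ| ≤ |s|) : σ ∈ Icc (-(ε / 2)) (ε / 2) :=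
    abs_le.1 (h.trans (hs'.le.trans (min_le_right _ _)))
  have hder (σ : ℝ) (h : σ ∈ uIcc 0 s) :
      HasDerivWithinAt (fun σ => F σ t (z t + σ * y t) - σ * Ψ (0, t)) (Ψ (σ, t) - Ψ (0, t))
        (uIcc 0 s) σ := by
    have h1 := hF.hasFDerivAt σ (hsub (hmem (hσ σ h))) t ht (z t + σ * y t)
    have h2 : HasDerivAt (fun σ : ℝ => (σ, z t + σ * y t)) (1, y t) σ := by
      simpa using (hasDerivAt_id σ).prodMk (((hasDerivAt_id σ).mul_const (y t)).const_add (z t))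
    have h3 := (h1.comp_hasDerivAt σ h2).sub ((hasDerivAt_id σ).mul_const (Ψ (0, t)))
    simpa using! h3.hasDerivWithinAt
  have hb := Convex.norm_image_sub_le_of_norm_hasDerivWithin_le hder (C := η)
    (fun σ h => by
      have := hδ' (σ, t) ⟨hmem (hσ σ h), ht⟩ (0, t) ⟨hmem (by simp), ht⟩ (by
        simpa [Prod.dist_eq] using ((hσ σ h).trans_lt hs').trans_le (min_le_left _ _))
      rw [Real.dist_eq] at this
      exact this.le) (convex_uIcc 0 s) left_mem_uIcc right_mem_uIcc
  simp only [hΨ, Real.norm_eq_abs, zero_mul, add_zero, sub_zero] at hb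
  convert! hb using 2
  ring

/-- The derivative of solutions with respect to the parameter solves the linearised equation. -/
theorem hasDerivAt_solution (hF : IsC1Family h ε F D) (hh : 0 < h) (hε : 0 < ε)
    (hz : Solves h (F 0) z) (hy : Solves h (fun t w => D 0 t (z t) (1, w)) y) (hy0 : y 0 = 0)
    {δ : ℝ} (hδ : 0 < δ) {Z : ℝ → ℝ → ℝ}
    (hZ : ∀ s ∈ Ioo (-δ) δ, Z s 0 = z 0 ∧ Solves h (F s) (Z s)) :
    HasDerivAt (fun s => Z s h) (y h) 0 := by
  obtain ⟨M₁, hM₁⟩ := exists_abs_le_of_continuousOn hz.continuousOn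
  obtain ⟨M₂, hM₂⟩ := exists_abs_le_of_continuousOn hy.continuousOn
  have h0 : (0 : ℝ) ∈ Icc 0 h := ⟨le_rfl, hh.le⟩
  have hhm : h ∈ Icc 0 h := ⟨hh.le, le_rfl⟩
  have hM₂0 : 0 ≤ M₂ := (abs_nonneg _).trans (hM₂ 0 h0)
  -- Room both for the true solutions, within `1` of `z`, and for `z + s y` with `|s| ≤ 1`.
  set M := M₁ + M₂ + 1 with hM
  obtain ⟨δ₁, hδ₁, hex⟩ := hF.exists_solves hh hε hz (M := M)
    (fun t ht => by have := hM₁ t ht; linarith)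
  obtain ⟨K, hK⟩ := hF.exists_lipschitzOnWith (half_lt_self hε) M
  -- `Z` is an arbitrary family of solutions; uniqueness transfers to it the bound on the
  -- constructed ones.
  have hbd (s : ℝ) (h1 : |s| < δ₁) (h2 : |s| < δ) (h3 : |s| < ε) :
      ∀ t ∈ Icc 0 h, |Z s t| ≤ M := by
    obtain ⟨α, hα0, hα, hαM⟩ := hex s (abs_lt.1 h1)
    obtain ⟨hZ0, hZs⟩ := hZ s (abs_lt.1 h2)
    intro t ht
    rw [hF.eqOn_of_solves (abs_lt.1 h3) hZs hα (hZ0.trans hα0.symm) ht]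
    exact hαM t ht
  have hZz : Z 0 h = z h := hF.eqOn_of_solves ⟨by linarith, hε⟩ (hZ 0 ⟨by linarith, hδ⟩).2 hz
    (hZ 0 ⟨by linarith, hδ⟩).1 hhm
  set C := gronwallBound 0 K 1 h with hC
  have hC0 : 0 ≤ C := by
    have := gronwallBound_mono (δ := 0) (ε := 1) le_rfl zero_le_one K.2 hh.le
    rwa [gronwallBound_x0] at this
  rw [hasDerivAt_iff_isLittleO, Asymptotics.isLittleO_iff]
  intro κ hκ
  -- Grönwall multiplies the defect by `C`, so this tolerance gives a final error of at most `κ *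
  -- |s|`; the `+ 1` avoids dividing by zero.
  obtain ⟨δ₂, hδ₂, hT⟩ := hF.exists_taylor_bound hε hz.continuousOn hy.continuousOn
    (η := κ / (C + 1)) (by positivity)
  have hmin : 0 < min (min δ δ₁) (min δ₂ (min (ε / 2) 1)) := by positivity
  filter_upwards [Metric.ball_mem_nhds (0 : ℝ) hmin] with s hs
  simp only [mem_ball_zero_iff, Real.norm_eq_abs, lt_min_iff] at hs
  obtain ⟨⟨hsδ, hs1⟩, hs2, hsε, hs1'⟩ := hs
  have hsm : s ∈ Icc (-(ε / 2)) (ε / 2) := abs_le.1 hsε.le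
  have hsZ := (hZ s (abs_lt.1 hsδ)).2
  have hg : ∀ t ∈ Icc 0 h, HasDerivWithinAt (fun t => z t + s * y t)
      (F 0 t (z t) + s * D 0 t (z t) (1, y t)) (Icc 0 h) t := fun t ht =>
    (hz t ht).add ((hy t ht).const_mul s)
  have h1 := dist_le_of_approx_trajectories_ODE_of_mem (v := F s) (K := K)
    (s := fun _ => Icc (-M) M) (f := Z s) (g := fun t => z t + s * y t) (a := 0) (b := h)
    (εf := 0) (εg := κ / (C + 1) * |s|) (δ := 0)
    (fun t ht => lipschitzOnWith_right (hK t (Ico_subset_Icc_self ht)) hsm) hsZ.continuousOn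
    (fun t ht => (hsZ t (Ico_subset_Icc_self ht)).Ici_of_Icc_zero ht)
    (fun t _ => by simp)
    (fun t ht => abs_le.1 (hbd s hs1 hsδ (by linarith) t (Ico_subset_Icc_self ht)))
    (fun t ht => (hg t ht).continuousWithinAt)
    (fun t ht => (hg t (Ico_subset_Icc_self ht)).Ici_of_Icc_zero ht)
    (fun t ht => by
      have := hT s (abs_lt.1 hs2) t (Ico_subset_Icc_self ht)
      rw [dist_comm, Real.dist_eq]
      rwa [sub_sub] at this)
    (fun t ht => by
      have ht' := Ico_subset_Icc_self ht
      refine abs_le.1 ((abs_add_le _ _).trans ?_)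
      have e1 := hM₁ t ht'
      have e2 : |s * y t| ≤ M₂ := by
        rw [abs_mul]
        exact (mul_le_mul hs1'.le (hM₂ t ht') (abs_nonneg _) zero_le_one).trans (by simp)
      linarith)
    (by simp [(hZ s (abs_lt.1 hsδ)).1, hy0]) h hhm
  rw [zero_add, sub_zero, gronwallBound_zero_eq_mul, ← hC, Real.dist_eq] at h1
  rw [hZz, sub_zero, smul_eq_mul, Real.norm_eq_abs, Real.norm_eq_abs, sub_sub]
  refine h1.trans ?_
  have h2 : κ / (C + 1) * |s| * C = κ * |s| * (C / (C + 1)) := by ring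
  rw [h2]
  refine mul_le_of_le_one_right (by positivity) ?_
  rw [div_le_one (by positivity)]
  linarith

end IsC1Family

end ScalarODE

/-! ### The derivative of the action. -/

section Action

variable {h ε : ℝ} {F : ℝ → ℝ → ℝ → ℝ} {D : ℝ → ℝ → ℝ → ℝ × ℝ →L[ℝ] ℝ} {z y : ℝ → ℝ}

theorem integral_eq_sub_of_hasDerivWithinAt_Icc (hh : 0 < h) {α α' : ℝ → ℝ}
    (hα : ∀ t ∈ Icc 0 h, HasDerivWithinAt α (α' t) (Icc 0 h) t) (hc : ContinuousOn α' (Icc 0 h)) :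
    ∫ t in (0 : ℝ)..h, α' t = α h - α 0 := by
  refine intervalIntegral.integral_eq_sub_of_hasDerivAt_of_le hh.le
    (fun t ht => (hα t ht).continuousWithinAt)
    (fun t ht => (hα t (Ioo_subset_Icc_self ht)).hasDerivAt (Icc_mem_nhds ht.1 ht.2)) ?_
  exact ContinuousOn.intervalIntegrable (by rwa [uIcc_of_le hh.le])

/-- A primitive of a continuous function on `[0, h]`. -/
theorem hasDerivWithinAt_integral_Icc (hh : 0 < h) {a : ℝ → ℝ} (ha : ContinuousOn a (Icc 0 h)) :
    ∀ t ∈ Icc 0 h, HasDerivWithinAt (fun t => ∫ τ in (0 : ℝ)..t, a τ) (a t) (Icc 0 h) t := by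
  intro t ht
  -- Extending by constants past the endpoints makes the two-sided fundamental theorem available
  -- there.
  have hc : Continuous (IccExtend hh.le ((Icc 0 h).domRestrict a)) :=
    (continuousOn_iff_continuous_domRestrict.1 ha).Icc_extend'
  have he : ∀ τ ∈ Icc 0 h, a τ = IccExtend hh.le ((Icc 0 h).domRestrict a) τ := fun τ hτ => by
    rw [IccExtend_of_mem hh.le _ hτ, domRestrict_apply]
  have h1 : HasDerivAt (fun t => ∫ τ in (0 : ℝ)..t, IccExtend hh.le ((Icc 0 h).domRestrict a) τ)
      (IccExtend hh.le ((Icc 0 h).domRestrict a) t) t :=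
    intervalIntegral.integral_hasDerivAt_right (hc.intervalIntegrable _ _)
      hc.stronglyMeasurable.stronglyMeasurableAtFilter hc.continuousAt
  rw [he t ht]
  refine h1.hasDerivWithinAt.congr_of_mem (fun s hs => ?_) ht
  refine intervalIntegral.integral_congr fun τ hτ => he τ ?_
  rw [uIcc_of_le hs.1] at hτ
  exact ⟨hτ.1, hτ.2.trans hs.2⟩

/-- The integrand is the time derivative of `Z s`, so the action is `Z s h - z 0` and its derivative
is `y h`. -/
theorem IsC1Family.actionStationary_iff (hF : IsC1Family h ε F D) (hh : 0 < h) (hε : 0 < ε)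
    (hz : Solves h (F 0) z) (hy : Solves h (fun t w => D 0 t (z t) (1, w)) y) (hy0 : y 0 = 0) :
    ActionStationary h (z 0) F ↔ y h = 0 := by
  have key {δ : ℝ} (hδ : 0 < δ) {Z : ℝ → ℝ → ℝ}
      (hZ : ∀ s ∈ Ioo (-δ) δ, Z s 0 = z 0 ∧ Solves h (F s) (Z s)) :
      HasDerivAt (fun s => ∫ t in (0 : ℝ)..h, F s t (Z s t)) (y h) 0 := by
    have h1 := (hF.hasDerivAt_solution hh hε hz hy hy0 hδ hZ).sub_const (z 0)
    refine h1.congr_of_eventuallyEq ?_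
    have hm : 0 < min δ ε := lt_min hδ hε
    filter_upwards [Ioo_mem_nhds (neg_lt_zero.2 hm) hm] with s hs
    have hsδ : s ∈ Ioo (-δ) δ := abs_lt.1 ((abs_lt.2 hs).trans_le (min_le_left _ _))
    have hsε : s ∈ Ioo (-ε) ε := abs_lt.1 ((abs_lt.2 hs).trans_le (min_le_right _ _))
    rw [← (hZ s hsδ).1]
    refine integral_eq_sub_of_hasDerivWithinAt_Icc hh (hZ s hsδ).2 ?_
    exact hF.continuousOn.comp
      (continuousOn_const.prodMk (continuousOn_id.prodMk (hZ s hsδ).2.continuousOn))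
      (fun t ht => ⟨hsε, ht, mem_univ _⟩)
  constructor
  · rintro ⟨δ, hδ, Z, hZ, hd⟩
    exact (key hδ hZ).unique hd
  · intro hyh
    obtain ⟨M, hM⟩ := exists_abs_le_of_continuousOn hz.continuousOn
    obtain ⟨δ, hδ, hex⟩ := hF.exists_solves hh hε hz (M := M + 1)
      (fun t ht => by have := hM t ht; linarith)
    choose! Z hZ0 hZ _ using hex
    refine ⟨δ, hδ, Z, fun s hs => ⟨hZ0 s hs, hZ s hs⟩, ?_⟩
    have := key hδ (fun s hs => ⟨hZ0 s hs, hZ s hs⟩)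
    rwa [hyh] at this

end Action

/-! ### First variation of the reduced action. -/

section Reduced

variable {E : Type*} [NormedAddCommGroup E] [NormedSpace ℝ E]

theorem uniqueDiffOn_strip {h ε : ℝ} (hh : 0 < h) : UniqueDiffOn ℝ (Ioo (-ε) ε ×ˢ Icc 0 h) :=
  isOpen_Ioo.uniqueDiffOn.prod (uniqueDiffOn_Icc hh)

theorem hasDerivAt_fst_of_contDiffOn {h ε : ℝ} {x : ℝ → ℝ → E}
    (hx : ContDiffOn ℝ ∞ (fun p : ℝ × ℝ => x p.1 p.2) (Ioo (-ε) ε ×ˢ Icc 0 h)) {s t : ℝ}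
    (hs : s ∈ Ioo (-ε) ε) (ht : t ∈ Icc 0 h) :
    HasDerivAt (fun s => x s t) (fderivWithin ℝ (fun p : ℝ × ℝ => x p.1 p.2)
      (Ioo (-ε) ε ×ˢ Icc 0 h) (s, t) (1, 0)) s := by
  have h1 := (hx.differentiableOn (by simp) (s, t) ⟨hs, ht⟩).hasFDerivWithinAt
  have h2 : HasDerivWithinAt (fun s : ℝ => (s, t)) ((1 : ℝ), (0 : ℝ)) (Ioo (-ε) ε) s :=
    ((hasDerivAt_id s).prodMk (hasDerivAt_const s t)).hasDerivWithinAt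
  have hm : MapsTo (fun s : ℝ => (s, t)) (Ioo (-ε) ε) (Ioo (-ε) ε ×ˢ Icc 0 h) :=
    fun σ hσ => ⟨hσ, ht⟩
  exact (h1.comp_hasDerivWithinAt s h2 hm).hasDerivAt (isOpen_Ioo.mem_nhds hs)

/-- The `s`-derivative of `x` is written as a derivative within the strip, which is jointly
continuous up to `t = 0` and `t = h`. -/
theorem isC1Family_lagrangian {l : E → ℝ → ℝ} (hl : ContDiff ℝ ∞ fun p : E × ℝ => l p.1 p.2)
    {h ε : ℝ} (hh : 0 < h) {x : ℝ → ℝ → E}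
    (hx : ContDiffOn ℝ ∞ (fun p : ℝ × ℝ => x p.1 p.2) (Ioo (-ε) ε ×ˢ Icc 0 h)) :
    IsC1Family h ε (fun s t w => l (x s t) w) (fun s t w =>
      (fderiv ℝ (fun p : E × ℝ => l p.1 p.2) (x s t, w)).comp
        (((ContinuousLinearMap.fst ℝ ℝ ℝ).smulRight (fderivWithin ℝ (fun p : ℝ × ℝ => x p.1 p.2)
          (Ioo (-ε) ε ×ˢ Icc 0 h) (s, t) (1, 0))).prod (ContinuousLinearMap.snd ℝ ℝ ℝ))) where
  hasFDerivAt s hs t ht w := by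
    have h1 := HasFDerivAt.comp (g := fun s => x s t) (s, w)
      (hasDerivAt_fst_of_contDiffOn hx hs ht).hasFDerivAt
      (hasFDerivAt_fst (𝕜 := ℝ) (p := ((s, w) : ℝ × ℝ)))
    have h2 := h1.prodMk (hasFDerivAt_snd (𝕜 := ℝ) (p := ((s, w) : ℝ × ℝ)))
    have h3 := HasFDerivAt.comp (g := fun p : E × ℝ => l p.1 p.2) (s, w)
      ((hl.differentiable (by simp)) (x s t, w)).hasFDerivAt h2
    refine h3.congr_fderiv ?_
    ext <;> simp
  continuousOn := by
    refine hl.continuous.comp_continuousOn (ContinuousOn.prodMk ?_ (by fun_prop))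
    exact hx.continuousOn.comp (f := fun q : ℝ × ℝ × ℝ => (q.1, q.2.1)) (by fun_prop)
      (fun q hq => ⟨hq.1, hq.2.1⟩)
  continuousOn_deriv := by
    have hm : MapsTo (fun q : ℝ × ℝ × ℝ => (q.1, q.2.1)) (Ioo (-ε) ε ×ˢ Icc 0 h ×ˢ univ)
      (Ioo (-ε) ε ×ˢ Icc 0 h) := fun q hq => ⟨hq.1, hq.2.1⟩
    have hxc := hx.continuousOn.comp (f := fun q : ℝ × ℝ × ℝ => (q.1, q.2.1)) (by fun_prop) hm
    have hdc := (hx.continuousOn_fderivWithin (uniqueDiffOn_strip hh) (by simp)).comp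
      (f := fun q : ℝ × ℝ × ℝ => (q.1, q.2.1)) (by fun_prop) hm
    have hdc' := hdc.clm_apply (continuousOn_const (c := ((1 : ℝ), (0 : ℝ))))
    have hsm : Continuous fun v : E => ((ContinuousLinearMap.fst ℝ ℝ ℝ).smulRight v).prod
        (ContinuousLinearMap.snd ℝ ℝ ℝ) := by
      have h1 : Continuous fun v : E => (ContinuousLinearMap.fst ℝ ℝ ℝ).smulRight v :=
        (ContinuousLinearMap.smulRightL ℝ (ℝ × ℝ) E (ContinuousLinearMap.fst ℝ ℝ ℝ)).continuous
      exact (ContinuousLinearMap.prodₗᵢ ℝ (𝕜 := ℝ)).continuous.comp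
        (h1.prodMk continuous_const)
    refine ContinuousOn.clm_comp ?_ (hsm.comp_continuousOn hdc')
    exact (hl.continuous_fderiv (by simp)).comp_continuousOn (hxc.prodMk (by fun_prop))

/-- The momentum `δl/δξ` along the curve `(ξ, z)`. -/
def momentum (l : E → ℝ → ℝ) (ξ : ℝ → E) (z : ℝ → ℝ) (t : ℝ) : E →L[ℝ] ℝ :=
  fderiv ℝ (fun y => l y (z t)) (ξ t)

/-- The defect `-d/dt δl/δξ + ad* δl/δξ + (∂l/∂z) δl/δξ` in the Euler-Poincaré-Herglotz equations,
for the bracket `B`. -/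
def ephResidual (B : E →L[ℝ] E →L[ℝ] E) (l : E → ℝ → ℝ) (h : ℝ) (ξ : ℝ → E) (z : ℝ → ℝ) (t : ℝ) :
    E →L[ℝ] ℝ :=
  (momentum l ξ z t).comp (B (ξ t)) + deriv (fun w => l (ξ t) w) (z t) • momentum l ξ z t
    - derivWithin (momentum l ξ z) (Icc 0 h) t

/-- The exponential of minus the integral of `∂l/∂z` along `(ξ, z)`. -/
def integratingFactor (l : E → ℝ → ℝ) (ξ : ℝ → E) (z : ℝ → ℝ) (t : ℝ) : ℝ :=
  Real.exp (-∫ τ in (0 : ℝ)..t, deriv (fun w => l (ξ τ) w) (z τ))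

variable {B : E →L[ℝ] E →L[ℝ] E} {l : E → ℝ → ℝ} {h ε : ℝ} {ξ η : ℝ → E} {z : ℝ → ℝ}

theorem momentum_eq (hl : ContDiff ℝ ∞ fun p : E × ℝ => l p.1 p.2) (t : ℝ) :
    momentum l ξ z t = (fderiv ℝ (fun p : E × ℝ => l p.1 p.2) (ξ t, z t)).comp
      (ContinuousLinearMap.inl ℝ E ℝ) :=
  (HasFDerivAt.comp (g := fun p : E × ℝ => l p.1 p.2) (f := fun e => (e, z t)) (ξ t)
    (hl.differentiable (by simp) (ξ t, z t)).hasFDerivAt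
    (hasFDerivAt_prodMk_left (ξ t) (z t))).fderiv

theorem deriv_lagrangian_eq (hl : ContDiff ℝ ∞ fun p : E × ℝ => l p.1 p.2) (x : E) (w : ℝ) :
    deriv (fun w => l x w) w = fderiv ℝ (fun p : E × ℝ => l p.1 p.2) (x, w) (0, 1) := by
  have h1 : HasDerivAt (fun w : ℝ => (x, w)) ((0 : E), (1 : ℝ)) w :=
    (hasDerivAt_const w x).prodMk (hasDerivAt_id w)
  exact ((hl.differentiable (by simp) (x, w)).hasFDerivAt.comp_hasDerivAt w h1).deriv

theorem fderiv_lagrangian_apply (hl : ContDiff ℝ ∞ fun p : E × ℝ => l p.1 p.2) (t : ℝ) (v : E)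
    (w : ℝ) : fderiv ℝ (fun p : E × ℝ => l p.1 p.2) (ξ t, z t) (v, w)
      = momentum l ξ z t v + deriv (fun w => l (ξ t) w) (z t) * w := by
  rw [momentum_eq hl, deriv_lagrangian_eq hl]
  have : (v, w) = (v, (0 : ℝ)) + w • ((0 : E), (1 : ℝ)) := by simp
  rw [this, map_add, map_smul]
  simp [mul_comm]

theorem contDiffOn_momentum (hl : ContDiff ℝ ∞ fun p : E × ℝ => l p.1 p.2)
    (hξ : ContDiffOn ℝ ∞ ξ (Icc 0 h)) (hz : ContDiffOn ℝ ∞ z (Icc 0 h)) :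
    ContDiffOn ℝ ∞ (momentum l ξ z) (Icc 0 h) := by
  have h1 : momentum l ξ z = fun t => (fderiv ℝ (fun p : E × ℝ => l p.1 p.2) (ξ t, z t)).comp
      (ContinuousLinearMap.inl ℝ E ℝ) := funext fun t => momentum_eq hl t
  rw [h1]
  have h2 : ContDiff ℝ ∞ (fderiv ℝ (fun p : E × ℝ => l p.1 p.2)) :=
    hl.fderiv_right (by simp)
  exact (h2.comp_contDiffOn (hξ.prodMk hz)).clm_comp contDiffOn_const

theorem continuousOn_deriv_lagrangian (hl : ContDiff ℝ ∞ fun p : E × ℝ => l p.1 p.2)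
    (hξ : ContDiffOn ℝ ∞ ξ (Icc 0 h)) (hz : ContDiffOn ℝ ∞ z (Icc 0 h)) :
    ContinuousOn (fun t => deriv (fun w => l (ξ t) w) (z t)) (Icc 0 h) := by
  simp only [deriv_lagrangian_eq hl]
  exact ((hl.continuous_fderiv (by simp)).comp_continuousOn
    (hξ.continuousOn.prodMk hz.continuousOn)).clm_apply continuousOn_const

theorem continuousOn_ephResidual (hh : 0 < h) (hl : ContDiff ℝ ∞ fun p : E × ℝ => l p.1 p.2)
    (hξ : ContDiffOn ℝ ∞ ξ (Icc 0 h)) (hz : ContDiffOn ℝ ∞ z (Icc 0 h)) :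
    ContinuousOn (ephResidual B l h ξ z) (Icc 0 h) := by
  have hp := contDiffOn_momentum hl hξ hz
  exact ((hp.continuousOn.clm_comp (B.continuous.comp_continuousOn hξ.continuousOn)).add
    ((continuousOn_deriv_lagrangian hl hξ hz).smul hp.continuousOn)).sub
    (hp.continuousOn_derivWithin (uniqueDiffOn_Icc hh) (by simp))

theorem hasDerivWithinAt_integratingFactor (hh : 0 < h)
    (hl : ContDiff ℝ ∞ fun p : E × ℝ => l p.1 p.2)
    (hξ : ContDiffOn ℝ ∞ ξ (Icc 0 h)) (hz : ContDiffOn ℝ ∞ z (Icc 0 h)) {t : ℝ}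
    (ht : t ∈ Icc 0 h) :
    HasDerivWithinAt (integratingFactor l ξ z)
      (-(deriv (fun w => l (ξ t) w) (z t)) * integratingFactor l ξ z t) (Icc 0 h) t := by
  have := (hasDerivWithinAt_integral_Icc hh (continuousOn_deriv_lagrangian hl hξ hz) t ht).neg.exp
  simpa [integratingFactor, mul_comm] using! this

/-- The first variation formula. -/
theorem actionStationary_iff_integral_ephResidual (hh : 0 < h) (hε : 0 < ε)
    (hl : ContDiff ℝ ∞ fun p : E × ℝ => l p.1 p.2)
    (hξ : ContDiffOn ℝ ∞ ξ (Icc 0 h)) (hz : ContDiffOn ℝ ∞ z (Icc 0 h))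
    (hη : ContDiffOn ℝ ∞ η (Icc 0 h)) (hη0 : η 0 = 0) (hηh : η h = 0)
    (hsol : ∀ t ∈ Icc 0 h, HasDerivWithinAt z (l (ξ t) (z t)) (Icc 0 h) t) {x : ℝ → ℝ → E}
    (hx : ContDiffOn ℝ ∞ (fun p : ℝ × ℝ => x p.1 p.2) (Ioo (-ε) ε ×ˢ Icc 0 h))
    (hxξ : ∀ t ∈ Icc 0 h, x 0 t = ξ t)
    (hvar : ∀ t ∈ Icc 0 h,
      HasDerivAt (fun s => x s t) (derivWithin η (Icc 0 h) t + B (ξ t) (η t)) 0) :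
    ActionStationary h (z 0) (fun s t w => l (x s t) w) ↔
      ∫ t in (0 : ℝ)..h, integratingFactor l ξ z t * ephResidual B l h ξ z t (η t) = 0 := by
  have hF := isC1Family_lagrangian hl hh hx
  set m := integratingFactor l ξ z with hm
  set p := momentum l ξ z with hp
  set R := ephResidual B l h ξ z with hR
  set a : ℝ → ℝ := fun t => deriv (fun w => l (ξ t) w) (z t) with ha
  have hm0 (t : ℝ) : m t ≠ 0 := (Real.exp_pos _).ne'
  have hmd (t : ℝ) (ht : t ∈ Icc 0 h) : HasDerivWithinAt m (-(a t) * m t) (Icc 0 h) t :=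
    hasDerivWithinAt_integratingFactor hh hl hξ hz ht
  have hcont : ContinuousOn (fun t => m t * R t (η t)) (Icc 0 h) :=
    ContinuousOn.mul (fun t ht => (hmd t ht).continuousWithinAt)
      ((continuousOn_ephResidual hh hl hξ hz).clm_apply hη.continuousOn)
  have hrd := hasDerivWithinAt_integral_Icc hh hcont
  set r : ℝ → ℝ := fun t => ∫ τ in (0 : ℝ)..t, m τ * R τ (η τ) with hr
  -- Variation of constants, with the boundary term `p(η)` of the integration by parts split off:
  -- then `y' = p(η' + B ξ η) + a y`, and `y h` reduces to `(m h)⁻¹ * r h`.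
  set y : ℝ → ℝ := fun t => p t (η t) + (m t)⁻¹ * r t with hy
  have h0ε : (0 : ℝ) ∈ Ioo (-ε) ε := ⟨by linarith, hε⟩
  have hyd : Solves h (fun t w => ((fderiv ℝ (fun p : E × ℝ => l p.1 p.2) (x 0 t, z t)).comp
        (((ContinuousLinearMap.fst ℝ ℝ ℝ).smulRight (fderivWithin ℝ (fun p : ℝ × ℝ => x p.1 p.2)
          (Ioo (-ε) ε ×ˢ Icc 0 h) (0, t) (1, 0))).prod (ContinuousLinearMap.snd ℝ ℝ ℝ))) (1, w))
      y := by
    intro t ht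
    have hpd : HasDerivWithinAt p (derivWithin p (Icc 0 h) t) (Icc 0 h) t :=
      ((contDiffOn_momentum hl hξ hz).differentiableOn (by simp) t ht).hasDerivWithinAt
    have hηd : HasDerivWithinAt η (derivWithin η (Icc 0 h) t) (Icc 0 h) t :=
      (hη.differentiableOn (by simp) t ht).hasDerivWithinAt
    have h1 := (hpd.clm_apply hηd).add (((hmd t ht).inv (hm0 t)).mul (hrd t ht))
    have h2 := (hasDerivAt_fst_of_contDiffOn hx h0ε ht).unique (hvar t ht)
    refine h1.congr_deriv ?_
    simp only [ContinuousLinearMap.comp_apply, ContinuousLinearMap.prod_apply,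
      ContinuousLinearMap.smulRight_apply, ContinuousLinearMap.coe_fst',
      ContinuousLinearMap.coe_snd', one_smul, h2, hxξ t ht, fderiv_lagrangian_apply hl]
    simp only [hy, hR, ha, Pi.inv_apply, ephResidual, _root_.sub_apply, _root_.add_apply,
      _root_.smul_apply, ContinuousLinearMap.comp_apply, map_add, smul_eq_mul]
    rw [← hp]
    have := hm0 t
    field_simp
    ring
  have hsol' : Solves h (fun t w => l (x 0 t) w) z := fun t ht => by
    simpa only [hxξ t ht] using hsol t ht
  rw [hF.actionStationary_iff hh hε hsol' hyd (by simp [hy, hη0, hr])]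
  simp only [hy, hηh, map_zero, zero_add, mul_eq_zero, inv_eq_zero, hm0, false_or, hr]

/-- The fundamental lemma of the calculus of variations, for the defect in the
Euler-Poincaré-Herglotz equations. -/
theorem ephResidual_eq_zero_of_integral_eq_zero (hh : 0 < h)
    (hl : ContDiff ℝ ∞ fun p : E × ℝ => l p.1 p.2)
    (hξ : ContDiffOn ℝ ∞ ξ (Icc 0 h)) (hz : ContDiffOn ℝ ∞ z (Icc 0 h))
    (hint : ∀ (f : ℝ → ℝ) (v : E), ContDiff ℝ ∞ f → HasCompactSupport f → tsupport f ⊆ Ioo 0 h →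
      ∫ t in (0 : ℝ)..h, integratingFactor l ξ z t * ephResidual B l h ξ z t (f t • v) = 0)
    {t : ℝ} (ht : t ∈ Icc 0 h) : ephResidual B l h ξ z t = 0 := by
  ext v
  set u : ℝ → ℝ := fun t => integratingFactor l ξ z t * ephResidual B l h ξ z t v with hu
  have huc : ContinuousOn u (Icc 0 h) := ContinuousOn.mul
    (fun t ht => (hasDerivWithinAt_integratingFactor hh hl hξ hz ht).continuousWithinAt)
    ((continuousOn_ephResidual hh hl hξ hz).clm_apply continuousOn_const)
  have hae := isOpen_Ioo.ae_eq_zero_of_integral_contDiff_smul_eq_zero (μ := MeasureTheory.volume)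
    (U := Ioo 0 h) (f := u)
    ((huc.mono Ioo_subset_Icc_self).locallyIntegrableOn measurableSet_Ioo)
    (fun f hf hfc hfs => by
      have h1 := hint f v hf hfc hfs
      rw [intervalIntegral.integral_of_le hh.le, MeasureTheory.integral_Ioc_eq_integral_Ioo] at h1
      rw [← h1, ← MeasureTheory.setIntegral_eq_integral_of_forall_compl_eq_zero (s := Ioo 0 h)]
      · refine MeasureTheory.setIntegral_congr_fun measurableSet_Ioo fun t _ => ?_
        simp only [hu, smul_eq_mul, map_smul]
        ring
      · intro t ht'
        rw [image_eq_zero_of_notMem_tsupport fun h' => ht' (hfs h'), zero_smul])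
  have h0 : EqOn u 0 (Ioo 0 h) := by
    refine MeasureTheory.Measure.eqOn_open_of_ae_eq (μ := MeasureTheory.volume) ?_ isOpen_Ioo
      (huc.mono Ioo_subset_Icc_self) continuousOn_const
    exact (MeasureTheory.ae_restrict_iff' measurableSet_Ioo).2 hae
  -- The test functions only see the open interval; continuity carries the vanishing to the
  -- endpoints.
  have h1 : EqOn u 0 (Icc 0 h) := by
    rw [← closure_Ioo hh.ne]
    exact h0.of_subset_closure (by rwa [closure_Ioo hh.ne]) continuousOn_const subset_closure
      subset_rfl
  exact (mul_eq_zero.1 (h1 ht)).resolve_left (Real.exp_pos _).ne'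

end Reduced

/-! ### Left trivialisation and variations of curves in the group. -/

section LieGroup

variable {E : Type*} [NormedAddCommGroup E] [NormedSpace ℝ E]
  {H : Type*} [TopologicalSpace H] {I : ModelWithCorners ℝ E H}
  {G : Type*} [TopologicalSpace G] [ChartedSpace H G] [Group G]

/-- Invariance applied to translation by `b⁻¹`. The base point `b⁻¹ * b` is only propositionally
`1`, hence the transport in `key`. -/
theorem lagrangian_eq_reducedLagrangian {L : TangentBundle I G × ℝ → ℝ}
    (hinv : LeftInvariant I L) (b : G) (u : E) (w : ℝ) :
    L ((⟨b, u⟩ : TangentBundle I G), w) = reducedLagrangian I L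
      (mfderiv I I (fun x => b⁻¹ * x) b u : TangentSpace I (b⁻¹ * b)) w := by
  rw [← hinv b⁻¹ ⟨b, u⟩ w]
  unfold reducedLagrangian
  congr 2
  have key (a : G) (ha : a = 1) (u : E) :
      (⟨a, u⟩ : TangentBundle I G) = (⟨1, u⟩ : TangentBundle I G) := by subst ha; rfl
  exact key _ (inv_mul_cancel b) _

theorem reducedLagrangian_bodyVelocity {L : TangentBundle I G × ℝ → ℝ} (hinv : LeftInvariant I L)
    (h : ℝ) (g : ℝ → G) (t w : ℝ) :
    reducedLagrangian I L (bodyVelocity I h g t) w = L (velocity I h g t, w) :=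
  (lagrangian_eq_reducedLagrangian hinv (g t) _ w).symm

theorem actionEquation_iff {L : TangentBundle I G × ℝ → ℝ} (hinv : LeftInvariant I L)
    (h : ℝ) (g : ℝ → G) (z : ℝ → ℝ) :
    ActionEquation I L h g z ↔
      ReducedActionEquation I (reducedLagrangian I L) h (bodyVelocity I h g) z := by
  simp only [ActionEquation, ReducedActionEquation, reducedLagrangian_bodyVelocity hinv]

/-- The tangent bundle trivialisation at `1` is the identity on the fibre over `1`. -/
theorem contMDiff_tangentBundle_mk_one [IsManifold I ∞ G] :
    ContMDiff 𝓘(ℝ, E) I.tangent ∞ (fun v : E => (⟨1, v⟩ : TangentBundle I G)) := by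
  intro v
  rw [Bundle.contMDiffAt_totalSpace]
  refine ⟨contMDiffAt_const, ?_⟩
  have : (fun v : E => (trivializationAt E (TangentSpace I) (1 : G)
      (⟨1, v⟩ : TangentBundle I G)).2) = id := by
    ext v
    have := (tangentBundleCore I G).coordChange_self (achart H 1) 1 (mem_chart_source H (1 : G)) v
    simpa using! this
  change ContMDiffAt 𝓘(ℝ, E) 𝓘(ℝ, E) ∞ (fun v : E => (trivializationAt E (TangentSpace I) (1 : G)
      (⟨1, v⟩ : TangentBundle I G)).2) v
  rw [this]
  exact contMDiffAt_id

theorem contDiff_reducedLagrangian [IsManifold I ∞ G] {L : TangentBundle I G × ℝ → ℝ}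
    (hL : ContMDiff (I.tangent.prod 𝓘(ℝ, ℝ)) 𝓘(ℝ, ℝ) ∞ L) :
    ContDiff ℝ ∞ (fun p : E × ℝ => reducedLagrangian I L p.1 p.2) := by
  rw [← contMDiff_iff_contDiff]
  exact hL.comp ((contMDiff_tangentBundle_mk_one.comp contDiff_fst.contMDiff).prodMk
    contDiff_snd.contMDiff)

variable [LieGroup I ∞ G]

theorem contDiffOn_bodyVelocity {h : ℝ} (hh : 0 < h) {g : ℝ → G}
    (hg : ContMDiffOn 𝓘(ℝ, ℝ) I ∞ g (Icc 0 h)) :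
    ContDiffOn ℝ ∞ (F := E) (bodyVelocity I h g) (Icc 0 h) :=
  ((contDiffOn_mcForm hg (uniqueDiffOn_Icc hh)).clm_apply contDiffOn_const).congr
    (fun t ht => bodyVelocity_eq_mcForm hh ht (hg t ht))

section Strip

variable {h ε : ℝ} {c : ℝ → ℝ → G}

theorem mcForm_strip_left
    (hc : ContMDiffOn 𝓘(ℝ, ℝ × ℝ) I ∞ (fun p : ℝ × ℝ => c p.1 p.2) (Ioo (-ε) ε ×ˢ Icc 0 h)) {s t : ℝ}
    (hs : s ∈ Ioo (-ε) ε) (ht : t ∈ Icc 0 h) :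
    mcForm I (fun p : ℝ × ℝ => c p.1 p.2) (Ioo (-ε) ε ×ˢ Icc 0 h) (s, t) (1, 0)
      = mcForm I (fun s => c s t) (Ioo (-ε) ε) s 1 := by
  have hk : HasDerivWithinAt (fun s : ℝ => (s, t)) ((1 : ℝ), (0 : ℝ)) (Ioo (-ε) ε) s :=
    ((hasDerivAt_id s).prodMk (hasDerivAt_const s t)).hasDerivWithinAt
  have hu : UniqueDiffWithinAt ℝ (Ioo (-ε) ε) s := isOpen_Ioo.uniqueDiffOn s hs
  have := mcForm_comp (I := I) (k := fun s : ℝ => (s, t)) (hc (s, t) ⟨hs, ht⟩)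
    hk.differentiableWithinAt hu (hk.continuousWithinAt.tendsto_nhdsWithin fun σ hσ => ⟨hσ, ht⟩)
  rw [this, ContinuousLinearMap.comp_apply, hk.hasFDerivWithinAt.fderivWithin hu]
  simp

theorem mcForm_strip_right (hh : 0 < h)
    (hc : ContMDiffOn 𝓘(ℝ, ℝ × ℝ) I ∞ (fun p : ℝ × ℝ => c p.1 p.2) (Ioo (-ε) ε ×ˢ Icc 0 h)) {s t : ℝ}
    (hs : s ∈ Ioo (-ε) ε) (ht : t ∈ Icc 0 h) :
    mcForm I (fun p : ℝ × ℝ => c p.1 p.2) (Ioo (-ε) ε ×ˢ Icc 0 h) (s, t) (0, 1)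
      = bodyVelocity I h (c s) t := by
  have hk : HasDerivWithinAt (fun t : ℝ => (s, t)) ((0 : ℝ), (1 : ℝ)) (Icc 0 h) t :=
    ((hasDerivAt_const t s).prodMk (hasDerivAt_id t)).hasDerivWithinAt
  have hu := uniqueDiffOn_Icc hh t ht
  have hm : MapsTo (fun t : ℝ => (s, t)) (Icc 0 h) (Ioo (-ε) ε ×ˢ Icc 0 h) := fun τ hτ => ⟨hs, hτ⟩
  have := mcForm_comp (I := I) (k := fun t : ℝ => (s, t)) (hc (s, t) ⟨hs, ht⟩)
    hk.differentiableWithinAt hu (hk.continuousWithinAt.tendsto_nhdsWithin hm)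
  have hcs : ContMDiffWithinAt 𝓘(ℝ, ℝ) I ∞ (c s) (Icc 0 h) t :=
    ContMDiffWithinAt.comp (I' := 𝓘(ℝ, ℝ × ℝ)) (g := fun p : ℝ × ℝ => c p.1 p.2)
      (f := fun t => (s, t)) t (hc (s, t) ⟨hs, ht⟩)
      ((contDiff_const.prodMk contDiff_id).contMDiff.contMDiffAt.contMDiffWithinAt) hm
  rw [bodyVelocity_eq_mcForm hh ht hcs]
  refine Eq.trans ?_ (congrArg (fun T : ℝ →L[ℝ] E => T 1) this).symm
  rw [ContinuousLinearMap.comp_apply, hk.hasFDerivWithinAt.fderivWithin hu]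
  simp

/-- The infinitesimal variation `c⁻¹ ∂c/∂s` at `s = 0`, in the Lie algebra. -/
def infinitesimalVariation (I : ModelWithCorners ℝ E H) (h ε : ℝ) (c : ℝ → ℝ → G) (t : ℝ) : E :=
  mcForm I (fun p : ℝ × ℝ => c p.1 p.2) (Ioo (-ε) ε ×ˢ Icc 0 h) (0, t) (1, 0)

/-- Makes `maurerCartan` applicable at the boundary times `0` and `h`. -/
theorem strip_subset_closure_interior (hh : 0 < h) :
    Ioo (-ε) ε ×ˢ Icc 0 h ⊆ closure (interior (Ioo (-ε) ε ×ˢ Icc 0 h)) := by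
  rw [interior_prod_eq, interior_Icc, interior_Ioo, closure_prod_eq, closure_Ioo hh.ne]
  exact prod_mono_left subset_closure

variable [I.Boundaryless]

/-- On the strip the logarithmic derivative has components `η` along `∂/∂s` and `ξ` along `∂/∂t`;
Maurer-Cartan for these two directions reads `∂ξ/∂s - ∂η/∂t = [ξ, η]`. -/
theorem hasDerivAt_bodyVelocity_variation [CompleteSpace E] (hh : 0 < h) (hε : 0 < ε)
    (hc : ContMDiffOn 𝓘(ℝ, ℝ × ℝ) I ∞ (fun p : ℝ × ℝ => c p.1 p.2) (Ioo (-ε) ε ×ˢ Icc 0 h)) {t : ℝ}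
    (ht : t ∈ Icc 0 h) :
    HasDerivAt (F := E) (fun s => bodyVelocity I h (c s) t)
      (derivWithin (infinitesimalVariation I h ε c) (Icc 0 h) t
        + algBracket I G (bodyVelocity I h (c 0) t) (infinitesimalVariation I h ε c t)) 0 := by
  set S := Ioo (-ε) ε ×ˢ Icc 0 h with hS
  set A := mcForm I (fun p : ℝ × ℝ => c p.1 p.2) S with hA
  have h0 : (0 : ℝ) ∈ Ioo (-ε) ε := ⟨by linarith, hε⟩
  have hSu : UniqueDiffOn ℝ S := uniqueDiffOn_strip hh
  have hp : ((0 : ℝ), t) ∈ S := ⟨h0, ht⟩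
  have hAd : HasFDerivWithinAt A (fderivWithin ℝ A S (0, t)) S (0, t) :=
    ((contDiffOn_mcForm hc hSu).differentiableOn (by simp) _ hp).hasFDerivWithinAt
  have hk1 : HasDerivWithinAt (fun s : ℝ => (s, t)) ((1 : ℝ), (0 : ℝ)) (Ioo (-ε) ε) 0 :=
    ((hasDerivAt_id (0 : ℝ)).prodMk (hasDerivAt_const 0 t)).hasDerivWithinAt
  have hm1 : MapsTo (fun s : ℝ => (s, t)) (Ioo (-ε) ε) S := fun σ hσ => ⟨hσ, ht⟩
  have hk2 : HasDerivWithinAt (fun t : ℝ => ((0 : ℝ), t)) ((0 : ℝ), (1 : ℝ)) (Icc 0 h) t :=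
    ((hasDerivAt_const t (0 : ℝ)).prodMk (hasDerivAt_id t)).hasDerivWithinAt
  have hm2 : MapsTo (fun t : ℝ => ((0 : ℝ), t)) (Icc 0 h) S := fun τ hτ => ⟨h0, hτ⟩
  have hx : HasDerivWithinAt (fun s => A (s, t) (0, 1)) (fderivWithin ℝ A S (0, t) (1, 0) (0, 1))
      (Ioo (-ε) ε) 0 := by
    have h1 : HasDerivWithinAt (fun s => A (s, t)) (fderivWithin ℝ A S (0, t) (1, 0))
      (Ioo (-ε) ε) 0 :=
      hAd.comp_hasDerivWithinAt (f := fun s : ℝ => (s, t)) (0 : ℝ) hk1 hm1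
    have h2 := h1.clm_apply (hasDerivWithinAt_const (0 : ℝ) (Ioo (-ε) ε) ((0 : ℝ), (1 : ℝ)))
    rwa [map_zero, add_zero] at h2
  have hη : HasDerivWithinAt (fun τ => A (0, τ) (1, 0)) (fderivWithin ℝ A S (0, t) (0, 1) (1, 0))
      (Icc 0 h) t := by
    have h1 : HasDerivWithinAt (fun τ => A (0, τ)) (fderivWithin ℝ A S (0, t) (0, 1))
      (Icc 0 h) t := hAd.comp_hasDerivWithinAt t hk2 hm2
    have h2 := h1.clm_apply (hasDerivWithinAt_const t (Icc 0 h) ((1 : ℝ), (0 : ℝ)))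
    rwa [map_zero, add_zero] at h2
  have hη' : derivWithin (infinitesimalVariation I h ε c) (Icc 0 h) t
      = fderivWithin ℝ A S (0, t) (0, 1) (1, 0) := hη.derivWithin (uniqueDiffOn_Icc hh t ht)
  have hMC := maurerCartan hc hSu hp (strip_subset_closure_interior hh hp) (1, 0) (0, 1)
  rw [mcForm_strip_right hh hc h0 ht, sub_eq_iff_eq_add'] at hMC
  have hx' := hx.hasDerivAt (isOpen_Ioo.mem_nhds h0)
  rw [hMC, ← hη'] at hx'
  refine hx'.congr_of_eventuallyEq ?_
  filter_upwards [isOpen_Ioo.mem_nhds h0] with s hs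
  exact (mcForm_strip_right hh hc hs ht).symm

end Strip

end LieGroup

/-! ### The variational principles and the Euler-Poincaré-Herglotz equations. -/

section Principles

variable {E : Type*} [NormedAddCommGroup E] [NormedSpace ℝ E]
  {H : Type*} [TopologicalSpace H] {I : ModelWithCorners ℝ E H}
  {G : Type*} [TopologicalSpace G] [ChartedSpace H G] [Group G]
  {h ε : ℝ} {g : ℝ → G} {c : ℝ → ℝ → G} {z : ℝ → ℝ}

theorem mcForm_const {V : Type*} [NormedAddCommGroup V] [NormedSpace ℝ V] (a : G) (S : Set V)
    (p : V) : mcForm I (fun _ => a) S p = 0 := by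
  unfold mcForm
  exact fderivWithin_const_apply _

theorem bodyVelocity_congr {g' : ℝ → G} (hg : EqOn g g' (Icc 0 h)) {t : ℝ} (ht : t ∈ Icc 0 h) :
    (bodyVelocity I h g t : E) = bodyVelocity I h g' t := by
  have h1 : mfderivWithin 𝓘(ℝ, ℝ) I g (Icc 0 h) t = mfderivWithin 𝓘(ℝ, ℝ) I g' (Icc 0 h) t :=
    mfderivWithin_congr hg (hg ht)
  unfold bodyVelocity velocity
  rw [h1, hg ht]

variable (I G) in
/-- The bracket of the Lie algebra as a continuous bilinear map on the model space. -/
def algBracketL [LieGroup I ∞ G] : E →L[ℝ] E →L[ℝ] E :=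
  (fderiv ℝ (mcForm I (extChartAt I (1 : G)).symm (extChartAt I (1 : G)).target)
    (extChartAt I (1 : G) 1)).flip -
  fderiv ℝ (mcForm I (extChartAt I (1 : G)).symm (extChartAt I (1 : G)).target)
    (extChartAt I (1 : G) 1)

variable [I.Boundaryless] [LieGroup I ∞ G]

theorem algBracketL_apply [CompleteSpace E] (v w : E) :
    algBracketL I G v w = algBracket I G v w :=
  fderiv_mcForm_extChartAt_symm_one w v

/-- At a fixed endpoint `s ↦ c s t` is constant, so its logarithmic derivative vanishes; the rest is
the strip form of Maurer-Cartan. -/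
theorem IsFixedEndpointVariation.isReducedVariation [CompleteSpace E] (hh : 0 < h) (hε : 0 < ε)
    (hc : IsFixedEndpointVariation I h ε g c) :
    IsReducedVariation I h ε (bodyVelocity I h g)
      (infinitesimalVariation (E := E) I h ε c)
      (fun s => bodyVelocity I h (c s)) := by
  have h0 : (0 : ℝ) ∈ Ioo (-ε) ε := ⟨by linarith, hε⟩
  have hA := contDiffOn_mcForm hc.smooth (uniqueDiffOn_strip hh)
  have hend {t : ℝ} (ht : t ∈ Icc 0 h) {a : G} (ha : ∀ s ∈ Ioo (-ε) ε, c s t = a) :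
      infinitesimalVariation I h ε c t = 0 := by
    unfold infinitesimalVariation
    rw [mcForm_strip_left hc.smooth h0 ht, mcForm_congr (f' := fun _ => a), mcForm_const]
    · rfl
    · filter_upwards [self_mem_nhdsWithin] with s hs using ha s hs
    · exact ha 0 h0
  refine ⟨?_, hend ⟨le_rfl, hh.le⟩ hc.left, hend ⟨hh.le, le_rfl⟩ hc.right, ?_, ?_, ?_⟩
  · have hm : MapsTo (fun t : ℝ => ((0 : ℝ), t)) (Icc 0 h) (Ioo (-ε) ε ×ˢ Icc 0 h) :=
      fun τ hτ => ⟨h0, hτ⟩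
    exact (hA.comp (contDiff_const.prodMk contDiff_id).contDiffOn hm).clm_apply contDiffOn_const
  · exact (hA.clm_apply (contDiffOn_const (c := ((0 : ℝ), (1 : ℝ))))).congr
      fun p hp => (mcForm_strip_right hh hc.smooth hp.1 hp.2).symm
  · exact fun t ht => bodyVelocity_congr hc.base ht
  · intro t ht
    have h1 := hasDerivAt_bodyVelocity_variation hh hε hc.smooth ht
    rw [bodyVelocity_congr (E := E) hc.base ht] at h1
    exact h1

theorem IsReducedVariation.actionStationary_iff [CompleteSpace E] (hh : 0 < h) (hε : 0 < ε)
    {l : E → ℝ → ℝ} (hl : ContDiff ℝ ∞ fun p : E × ℝ => l p.1 p.2) {ξ η : ℝ → E} {x : ℝ → ℝ → E}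
    (hξ : ContDiffOn ℝ ∞ ξ (Icc 0 h)) (hz : ContDiffOn ℝ ∞ z (Icc 0 h))
    (hsol : ReducedActionEquation I (G := G) l h ξ z)
    (hx : IsReducedVariation I (G := G) h ε ξ η x) :
    ActionStationary h (z 0) (fun s t w => l (x s t) w) ↔
      ∫ t in (0 : ℝ)..h, integratingFactor l ξ z t *
        ephResidual (algBracketL I G) l h ξ z t (η t) = 0 := by
  refine actionStationary_iff_integral_ephResidual hh hε hl hξ hz hx.smooth_curve hx.left hx.right
    hsol hx.smooth hx.base fun t ht => ?_
  rw [algBracketL_apply]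
  exact hx.variation t ht

/-- The momentum is smooth along smooth curves, so the differential equation is just an identity for
its `derivWithin`. -/
theorem eulerPoincareHerglotz_iff [FiniteDimensional ℝ E] (hh : 0 < h)
    {l : E → ℝ → ℝ} (hl : ContDiff ℝ ∞ fun p : E × ℝ => l p.1 p.2) {ξ : ℝ → E}
    (hξ : ContDiffOn ℝ ∞ ξ (Icc 0 h)) (hz : ContDiffOn ℝ ∞ z (Icc 0 h)) :
    EulerPoincareHerglotz I (G := G) l h ξ z ↔
      (∀ t ∈ Icc 0 h, ephResidual (algBracketL I G) l h ξ z t = 0) ∧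
        ReducedActionEquation I (G := G) l h ξ z := by
  have : CompleteSpace E := FiniteDimensional.complete ℝ E
  refine and_congr_left' (forall₂_congr fun t ht => ?_)
  have hcoad : (coad I (G := G) (ξ t) (functionalDeriv I (G := G) l (ξ t) (z t)) : E →L[ℝ] ℝ)
      = (momentum l ξ z t).comp (algBracketL I G (ξ t)) := by
    refine ContinuousLinearMap.ext (M₁ := E) fun v => ?_
    exact congrArg (momentum l ξ z t) (algBracketL_apply (I := I) (G := G) (ξ t) v).symm
  have hp : HasDerivWithinAt (momentum l ξ z) (derivWithin (momentum l ξ z) (Icc 0 h) t)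
      (Icc 0 h) t :=
    ((contDiffOn_momentum hl hξ hz).differentiableOn (by simp) t ht).hasDerivWithinAt
  have hiff : HasDerivWithinAt (momentum l ξ z)
      ((momentum l ξ z t).comp (algBracketL I G (ξ t))
        + deriv (fun w => l (ξ t) w) (z t) • momentum l ξ z t) (Icc 0 h) t ↔
      ephResidual (algBracketL I G) l h ξ z t = 0 := by
    unfold ephResidual
    rw [sub_eq_zero]
    constructor
    · exact fun h1 => (h1.derivWithin (uniqueDiffOn_Icc hh t ht)).symm
    · intro h1
      rw [h1]
      exact hp
  rw [← hiff, ← hcoad]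
  rfl

/-- Every infinitesimal variation with values in a line comes from a fixed-endpoint variation. -/
theorem exists_isFixedEndpointVariation (hh : 0 < h) (hg : ContMDiffOn 𝓘(ℝ, ℝ) I ∞ g (Icc 0 h))
    {f : ℝ → ℝ} (hf : ContDiff ℝ ∞ f) (hfc : HasCompactSupport f) (hfs : tsupport f ⊆ Ioo 0 h)
    (v : E) : ∃ ε > 0, ∃ c : ℝ → ℝ → G, IsFixedEndpointVariation I h ε g c ∧
      ∀ t ∈ Icc 0 h, infinitesimalVariation I h ε c t = f t • v := by
  set o := extChartAt I (1 : G) 1 with ho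
  obtain ⟨ρ, hρ, hball⟩ := Metric.mem_nhds_iff.1 (extChartAt_one_target_mem_nhds (I := I) (G := G))
  obtain ⟨C, hC⟩ := hf.continuous.bounded_above_of_compact_support hfc
  have hC0 : 0 ≤ C := (norm_nonneg _).trans (hC 0)
  -- Small enough that `o + (s * f t) • v` stays in the ball inside the chart target; the `+ 1`
  -- covers `C * ‖v‖ = 0`.
  set ε := ρ / (C * ‖v‖ + 1) with hε
  have hεpos : 0 < ε := by positivity
  set c : ℝ → ℝ → G := fun s t => g t * (extChartAt I (1 : G)).symm (o + (s * f t) • v) with hc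
  have hmem {s : ℝ} (hs : s ∈ Ioo (-ε) ε) (t : ℝ) :
      o + (s * f t) • v ∈ (extChartAt I (1 : G)).target := by
    apply hball
    rw [Metric.mem_ball, dist_eq_norm, add_sub_cancel_left, norm_smul, norm_mul]
    have h1 : ‖s‖ < ε := abs_lt.2 hs
    calc ‖s‖ * ‖f t‖ * ‖v‖ = ‖s‖ * (‖f t‖ * ‖v‖) := by ring
      _ ≤ ‖s‖ * (C * ‖v‖) := by gcongr; exact hC t
      _ ≤ ε * (C * ‖v‖) := by gcongr
      _ < ε * (C * ‖v‖ + 1) := by gcongr; linarith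
      _ = ρ := by rw [hε]; field_simp
  have h0ε : (0 : ℝ) ∈ Ioo (-ε) ε := ⟨by linarith, hεpos⟩
  have hsm : ContMDiffOn 𝓘(ℝ, ℝ × ℝ) I ∞ (fun p : ℝ × ℝ => c p.1 p.2)
      (Ioo (-ε) ε ×ˢ Icc 0 h) := by
    have h1 : ContMDiffOn 𝓘(ℝ, ℝ × ℝ) I ∞ (fun p : ℝ × ℝ => g p.2) (Ioo (-ε) ε ×ˢ Icc 0 h) :=
      hg.comp (I' := 𝓘(ℝ, ℝ)) contDiff_snd.contMDiff.contMDiffOn fun p hp => hp.2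
    have h2 : ContDiff ℝ ∞ (fun p : ℝ × ℝ => o + (p.1 * f p.2) • v) :=
      contDiff_const.add ((contDiff_fst.mul (hf.comp contDiff_snd)).smul contDiff_const)
    exact h1.mul (contMDiffOn_extChartAt_one_symm.comp h2.contMDiff.contMDiffOn
      fun p hp => hmem hp.1 p.2)
  have hzero {s t : ℝ} (h1 : s * f t = 0) : c s t = g t := by
    simp only [hc, h1, zero_smul, add_zero, ho, extChartAt_one_symm_self, mul_one]
  have hfend {t : ℝ} (ht : t ∉ Ioo 0 h) : f t = 0 :=
    image_eq_zero_of_notMem_tsupport fun h' => ht (hfs h')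
  refine ⟨ε, hεpos, c, ⟨hsm, fun t _ => hzero (zero_mul _),
    fun s _ => hzero (by rw [hfend (by simp), mul_zero]),
    fun s _ => hzero (by rw [hfend (by simp), mul_zero])⟩, fun t ht => ?_⟩
  unfold infinitesimalVariation
  have hk : HasDerivWithinAt (fun s : ℝ => o + (s * f t) • v) (f t • v) (Ioo (-ε) ε) 0 := by
    simpa using ((((hasDerivAt_id (0 : ℝ)).mul_const (f t)).smul_const v).const_add
      o).hasDerivWithinAt
  have hu : UniqueDiffWithinAt ℝ (Ioo (-ε) ε) 0 := isOpen_Ioo.uniqueDiffOn 0 h0ε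
  have hk0 : o + ((0 : ℝ) * f t) • v = o := by simp
  -- For fixed `t` the left factor `g t` drops out, and the inverse chart has logarithmic derivative
  -- `id` at `o`, leaving the velocity `f t • v`.
  rw [mcForm_strip_left hsm h0ε ht, mcForm_const_mul, mcForm_comp
    (k := fun s : ℝ => o + (s * f t) • v) (contMDiffOn_extChartAt_one_symm _ (hmem h0ε t))
    hk.differentiableWithinAt hu
    (hk.continuousWithinAt.tendsto_nhdsWithin fun s hs => hmem hs t), hk0,
    mcForm_extChartAt_symm_one, hk.hasFDerivWithinAt.fderivWithin hu]
  simp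

variable [FiniteDimensional ℝ E] {L : TangentBundle I G × ℝ → ℝ}

theorem reducedHerglotzPrinciple_of_eulerPoincareHerglotz (hh : 0 < h)
    (hL : ContMDiff (I.tangent.prod 𝓘(ℝ, ℝ)) 𝓘(ℝ, ℝ) ∞ L)
    (hg : ContMDiffOn 𝓘(ℝ, ℝ) I ∞ g (Icc 0 h)) (hz : ContDiffOn ℝ ∞ z (Icc 0 h))
    (hE : EulerPoincareHerglotz I (reducedLagrangian I L) h (bodyVelocity I h g) z) :
    ReducedHerglotzPrinciple I (reducedLagrangian I L) h (bodyVelocity I h g) z := by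
  have : CompleteSpace E := FiniteDimensional.complete ℝ E
  have hl := contDiff_reducedLagrangian hL
  have hξ := contDiffOn_bodyVelocity hh hg
  obtain ⟨hR, hA⟩ := (eulerPoincareHerglotz_iff (E := E) hh hl hξ hz).1 hE
  refine ⟨hA, fun ε hε η x hx => ?_⟩
  refine (hx.actionStationary_iff (E := E) hh hε hl hξ hz hA).2 ?_
  rw [intervalIntegral.integral_congr (g := fun _ => 0), intervalIntegral.integral_zero]
  intro t ht
  rw [uIcc_of_le hh.le] at ht
  simp only [hR t ht]
  exact mul_zero _

theorem herglotzPrinciple_of_reducedHerglotzPrinciple (hh : 0 < h) (hinv : LeftInvariant I L)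
    (hE : ReducedHerglotzPrinciple I (reducedLagrangian I L) h (bodyVelocity I h g) z) :
    HerglotzPrinciple I L h g z := by
  have : CompleteSpace E := FiniteDimensional.complete ℝ E
  refine ⟨(actionEquation_iff hinv h g z).2 hE.1, fun ε hε c hc => ?_⟩
  have := hE.2 ε hε _ _ (hc.isReducedVariation hh hε)
  simpa only [reducedLagrangian_bodyVelocity hinv] using this

/-- Variations with `η = f v`, for `f` compactly supported in the open interval, already suffice for
the fundamental lemma. -/
theorem eulerPoincareHerglotz_of_herglotzPrinciple (hh : 0 < h)
    (hL : ContMDiff (I.tangent.prod 𝓘(ℝ, ℝ)) 𝓘(ℝ, ℝ) ∞ L) (hinv : LeftInvariant I L)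
    (hg : ContMDiffOn 𝓘(ℝ, ℝ) I ∞ g (Icc 0 h)) (hz : ContDiffOn ℝ ∞ z (Icc 0 h))
    (hE : HerglotzPrinciple I L h g z) :
    EulerPoincareHerglotz I (reducedLagrangian I L) h (bodyVelocity I h g) z := by
  have : CompleteSpace E := FiniteDimensional.complete ℝ E
  have hl := contDiff_reducedLagrangian hL
  have hξ := contDiffOn_bodyVelocity hh hg
  have hA := (actionEquation_iff hinv h g z).1 hE.1
  refine (eulerPoincareHerglotz_iff (E := E) hh hl hξ hz).2 ⟨fun t ht => ?_, hA⟩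
  refine ephResidual_eq_zero_of_integral_eq_zero hh hl hξ hz (fun f v hf hfc hfs => ?_) ht
  obtain ⟨ε, hε, c, hc, hcη⟩ := exists_isFixedEndpointVariation hh hg hf hfc hfs v
  have h1 := hE.2 ε hε c hc
  simp only [← reducedLagrangian_bodyVelocity hinv] at h1
  have h2 := (IsReducedVariation.actionStationary_iff (E := E) hh hε hl hξ hz hA
    (hc.isReducedVariation hh hε)).1 h1
  refine (intervalIntegral.integral_congr fun t ht => ?_).trans h2
  rw [uIcc_of_le hh.le] at ht
  simp only [hcη t ht]

end Principles

/-! ### The Herglotz equations in charts. -/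

section Charts

variable {E : Type*} [NormedAddCommGroup E] [NormedSpace ℝ E]
  {H : Type*} [TopologicalSpace H] {I : ModelWithCorners ℝ E H}
  {G : Type*} [TopologicalSpace G] [ChartedSpace H G]
  {h : ℝ} {g : ℝ → G} {z : ℝ → ℝ} {L : TangentBundle I G × ℝ → ℝ} {e : OpenPartialHomeomorph G H}

theorem contMDiffOn_extend_symm_target (he : e ∈ IsManifold.maximalAtlas I ∞ G) :
    ContMDiffOn 𝓘(ℝ, E) I ∞ (e.extend I).symm (e.extend I).target := by
  rw [e.extend_target']
  exact contMDiffOn_extend_symm he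

variable [Group G] [LieGroup I ∞ G] [I.Boundaryless]

theorem localLagrangian_eq (hinv : LeftInvariant I L) (he : e ∈ IsManifold.maximalAtlas I ∞ G)
    {q : E} (hq : q ∈ (e.extend I).target) (v : E) (w : ℝ) :
    localLagrangian I L e q v w =
      reducedLagrangian I L (mcForm I (e.extend I).symm (e.extend I).target q v : E) w := by
  have ho : IsOpen (e.extend I).target := e.isOpen_extend_target
  refine (lagrangian_eq_reducedLagrangian hinv _ _ w).trans ?_
  rw [mcForm_eq_mfderiv (contMDiffOn_extend_symm_target he q hq) (ho.uniqueDiffWithinAt hq),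
    mfderivWithin_of_mem_nhds (ho.mem_nhds hq)]

theorem bodyVelocity_eq_chart (hh : 0 < h) (he : e ∈ IsManifold.maximalAtlas I ∞ G)
    (hg : ContMDiffOn 𝓘(ℝ, ℝ) I ∞ g (Icc 0 h)) {t : ℝ} (ht : t ∈ Icc 0 h) (hte : g t ∈ e.source) :
    bodyVelocity I h g t = (mcForm I (e.extend I).symm (e.extend I).target (e.extend I (g t))
      (derivWithin (fun τ => e.extend I (g τ)) (Icc 0 h) t) : E) := by
  have ho : IsOpen (e.extend I).target := e.isOpen_extend_target
  have hqT : e.extend I (g t) ∈ (e.extend I).target :=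
    (e.extend I).map_source (by rwa [e.extend_source])
  have hq : ContDiffWithinAt ℝ ∞ (fun τ => e.extend I (g τ)) (Icc 0 h) t := by
    rw [← contMDiffWithinAt_iff_contDiffWithinAt]
    exact (e.contMDiffAt_extend he hte).comp_contMDiffWithinAt t (hg t ht)
  have hev : ∀ᶠ τ in 𝓝[Icc 0 h] t, g τ = (e.extend I).symm (e.extend I (g τ)) := by
    filter_upwards [(hg t ht).continuousWithinAt.eventually_mem (e.open_source.mem_nhds hte)]
      with τ hτ
    rw [e.extend_left_inv hτ]
  rw [bodyVelocity_eq_mcForm hh ht (hg t ht), mcForm_congr hev (hev.self_of_nhdsWithin ht),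
    mcForm_comp (k := fun τ => e.extend I (g τ)) (contMDiffOn_extend_symm_target he _ hqT)
      (hq.differentiableWithinAt (by simp)) (uniqueDiffOn_Icc hh t ht)
      (by rw [ho.nhdsWithin_eq hqT]; exact hq.continuousWithinAt)]
  rfl

/-- Near `o`, the translate by `b` of the inverse chart at `1` is the inverse of `e` composed with
the transition map `k`. The chain rule then gives `id = A(q) ∘ Dk(o)`, a right inverse. -/
theorem mcForm_extend_symm_surjective (he : e ∈ IsManifold.maximalAtlas I ∞ G) {q : E}
    (hq : q ∈ (e.extend I).target) :
    Function.Surjective (mcForm I (e.extend I).symm (e.extend I).target q) := by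
  have ho : IsOpen (e.extend I).target := e.isOpen_extend_target
  set b := (e.extend I).symm q with hb
  have hbs : b ∈ e.source := by
    rw [← e.extend_source (I := I)]; exact (e.extend I).map_target hq
  set o := extChartAt I (1 : G) 1 with hodef
  set k : E → E := fun x => e.extend I (b * (extChartAt I (1 : G)).symm x) with hk
  have hso : b * (extChartAt I (1 : G)).symm o = b := by
    rw [hodef, extChartAt_one_symm_self, mul_one]
  have hko : k o = q := by simp only [hk, hso]; exact (e.extend I).right_inv hq
  have hc : ContMDiffAt 𝓘(ℝ, E) I ∞ (fun x => b * (extChartAt I (1 : G)).symm x) o :=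
    contMDiffAt_const.mul
      (contMDiffOn_extChartAt_one_symm.contMDiffAt extChartAt_one_target_mem_nhds)
  have hkd : ContDiffAt ℝ ∞ k o := by
    rw [← contMDiffAt_iff_contDiffAt]
    exact ContMDiffAt.comp o (by rw [hso]; exact e.contMDiffAt_extend he hbs) hc
  have hev : (fun x => b * (extChartAt I (1 : G)).symm x)
      =ᶠ[𝓝[(extChartAt I (1 : G)).target] o] fun x => (e.extend I).symm (k x) := by
    refine Filter.Eventually.filter_mono nhdsWithin_le_nhds ?_
    filter_upwards [hc.continuousAt.eventually_mem
      (e.open_source.mem_nhds (by simp only [hso]; exact hbs))] with x hx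
    exact (e.extend_left_inv hx).symm
  have h1 := mcForm_extChartAt_symm_one (I := I) (G := G)
  rw [← mcForm_const_mul b, mcForm_congr hev (by simp only [hso, hko]; exact hb),
    mcForm_comp (k := k) (S := (e.extend I).target)
      (by rw [hko]; exact contMDiffOn_extend_symm_target he q hq)
      (hkd.differentiableAt (by simp)).differentiableWithinAt
      ((isOpen_extChartAt_target (1 : G)).uniqueDiffWithinAt (mem_extChartAt_target 1))
      (by rw [hko, ho.nhdsWithin_eq hq, ← hko]
          exact hkd.continuousAt.continuousWithinAt), hko] at h1
  intro v
  exact ⟨_, congrArg (fun T : E →L[ℝ] E => T v) h1⟩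

/-- In the chart, `∂L/∂q̇ = p ∘ A(q)` and `∂L/∂q` sends `δ` to `p(DA(δ) q')`, while the time
derivative of `p ∘ A(q)` produces `p(DA(q') δ)`. By Maurer-Cartan the difference of the two `DA`
terms is `[ξ, A δ]`, the `ad*` term. -/
theorem herglotzEquation_iff_ephResidual [CompleteSpace E] (hh : 0 < h)
    (hL : ContMDiff (I.tangent.prod 𝓘(ℝ, ℝ)) 𝓘(ℝ, ℝ) ∞ L) (hinv : LeftInvariant I L)
    (hg : ContMDiffOn 𝓘(ℝ, ℝ) I ∞ g (Icc 0 h)) (hz : ContDiffOn ℝ ∞ z (Icc 0 h))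
    (he : e ∈ IsManifold.maximalAtlas I ∞ G) {t : ℝ} (ht : t ∈ Icc 0 h) (hte : g t ∈ e.source) :
    let Le := localLagrangian I L e
    let q : ℝ → E := fun τ => e.extend I (g τ)
    let q' : ℝ → E := derivWithin q (Icc 0 h)
    HasDerivWithinAt (fun τ => fderiv ℝ (fun v => Le (q τ) v (z τ)) (q' τ))
      (fderiv ℝ (fun x => Le x (q' t) (z t)) (q t)
        + deriv (fun w => Le (q t) (q' t) w) (z t) •
          fderiv ℝ (fun v => Le (q t) v (z t)) (q' t))
      (Icc 0 h) t ↔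
    ephResidual (E := E) (algBracketL I G) (reducedLagrangian I L) h (bodyVelocity I h g) z t
      = 0 := by
  intro Le q q'
  have ho : IsOpen (e.extend I).target := e.isOpen_extend_target
  set T := (e.extend I).target with hT
  set A := mcForm I (e.extend I).symm T with hA
  set l : E → ℝ → ℝ := reducedLagrangian I L with hldef
  set ξ : ℝ → E := bodyVelocity I h g with hξdef
  have hl : ContDiff ℝ ∞ fun p : E × ℝ => l p.1 p.2 := contDiff_reducedLagrangian hL
  have hξ : ContDiffOn ℝ ∞ ξ (Icc 0 h) := contDiffOn_bodyVelocity hh hg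
  have hu := uniqueDiffOn_Icc hh t ht
  have hqT {τ : ℝ} (hτ : g τ ∈ e.source) : q τ ∈ T :=
    (e.extend I).map_source (by rwa [e.extend_source])
  have hLe {x : E} (hx : x ∈ T) (v : E) (w : ℝ) : Le x v w = l (A x v) w :=
    localLagrangian_eq hinv he hx v w
  have hξq {τ : ℝ} (hτ : τ ∈ Icc 0 h) (hτe : g τ ∈ e.source) : ξ τ = A (q τ) (q' τ) :=
    bodyVelocity_eq_chart hh he hg hτ hτe
  have hld (x : E) (w : ℝ) : HasFDerivAt (fun y => l y w) (fderiv ℝ (fun y => l y w) x) x :=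
    ((hl.comp (contDiff_id.prodMk contDiff_const)).differentiable (by simp) x).hasFDerivAt
  have hmom {τ : ℝ} (hτ : τ ∈ Icc 0 h) (hτe : g τ ∈ e.source) :
      fderiv ℝ (fun v => Le (q τ) v (z τ)) (q' τ) = (momentum l ξ z τ).comp (A (q τ)) := by
    have h1 : (fun v => Le (q τ) v (z τ)) = fun v => l (A (q τ) v) (z τ) :=
      funext fun v => hLe (hqT hτe) v _
    rw [h1, momentum, hξq hτ hτe]
    exact ((hld _ _).comp (q' τ) (A (q τ)).hasFDerivAt).fderiv
  have hAd : HasFDerivAt A (fderiv ℝ A (q t)) (q t) :=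
    (((contDiffOn_mcForm (contMDiffOn_extend_symm_target he) ho.uniqueDiffOn).contDiffAt
      (ho.mem_nhds (hqT hte))).differentiableAt (by simp)).hasFDerivAt
  have hpos (δ : E) : fderiv ℝ (fun x => Le x (q' t) (z t)) (q t) δ
      = momentum l ξ z t (fderiv ℝ A (q t) δ (q' t)) := by
    have h1 : (fun x => Le x (q' t) (z t)) =ᶠ[𝓝 (q t)] fun x => l (A x (q' t)) (z t) := by
      filter_upwards [ho.mem_nhds (hqT hte)] with x hx using hLe hx _ _
    have h2 := hAd.clm_apply (hasFDerivAt_const (q' t) (q t))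
    have h3 : fderiv ℝ (fun x => l (A x (q' t)) (z t)) (q t) = _ :=
      (HasFDerivAt.comp (g := fun y => l y (z t)) (q t) (hld _ _) h2).fderiv
    rw [h1.fderiv_eq, momentum, hξq ht hte, h3]
    simp
  have hw : deriv (fun w => Le (q t) (q' t) w) (z t) = deriv (fun w => l (ξ t) w) (z t) := by
    rw [hξq ht hte]
    congr 1
    exact funext fun w => hLe (hqT hte) _ w
  have hq : HasDerivWithinAt q (q' t) (Icc 0 h) t := by
    have : ContDiffWithinAt ℝ ∞ q (Icc 0 h) t := by
      rw [← contMDiffWithinAt_iff_contDiffWithinAt]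
      exact (e.contMDiffAt_extend he hte).comp_contMDiffWithinAt t (hg t ht)
    exact (this.differentiableWithinAt (by simp)).hasDerivWithinAt
  have hp : HasDerivWithinAt (momentum l ξ z) (derivWithin (momentum l ξ z) (Icc 0 h) t)
      (Icc 0 h) t :=
    ((contDiffOn_momentum hl hξ hz).differentiableOn (by simp) t ht).hasDerivWithinAt
  have hev : (fun τ => fderiv ℝ (fun v => Le (q τ) v (z τ)) (q' τ)) =ᶠ[𝓝[Icc 0 h] t]
      fun τ => (momentum l ξ z τ).comp (A (q τ)) := by
    filter_upwards [(hg t ht).continuousWithinAt.eventually_mem (e.open_source.mem_nhds hte),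
      self_mem_nhdsWithin] with τ hτ hτ' using hmom hτ' hτ
  have hder := (hp.clm_comp (hAd.comp_hasDerivWithinAt t hq)).congr_of_eventuallyEq hev
    (hev.self_of_nhdsWithin ht)
  have hMC (δ : E) : fderiv ℝ A (q t) δ (q' t) - fderiv ℝ A (q t) (q' t) δ
      = algBracketL I G (ξ t) (A (q t) δ) := by
    have := maurerCartan (contMDiffOn_extend_symm_target he) ho.uniqueDiffOn (hqT hte)
      (by rw [ho.interior_eq]; exact subset_closure (hqT hte)) δ (q' t)
    rw [fderivWithin_of_isOpen ho (hqT hte)] at this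
    rw [algBracketL_apply, hξq ht hte]
    exact this
  have hres (δ : E) : ephResidual (algBracketL I G) l h ξ z t (A (q t) δ)
      = (fderiv ℝ (fun x => Le x (q' t) (z t)) (q t)
        + deriv (fun w => Le (q t) (q' t) w) (z t) • fderiv ℝ (fun v => Le (q t) v (z t)) (q' t)) δ
        - ((derivWithin (momentum l ξ z) (Icc 0 h) t).comp (A (q t))
          + (momentum l ξ z t).comp (fderiv ℝ A (q t) (q' t))) δ := by
    rw [hmom ht hte, hw]
    simp only [ephResidual, _root_.sub_apply, _root_.add_apply, _root_.smul_apply,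
      ContinuousLinearMap.comp_apply, hpos, ← hMC, map_sub]
    ring
  constructor
  · intro h1
    have h2 := (hder.derivWithin hu).symm.trans (h1.derivWithin hu)
    ext v
    -- The chart equation only tests the defect on vectors `A(q) δ`; these exhaust the Lie algebra.
    obtain ⟨δ, rfl⟩ := mcForm_extend_symm_surjective he (hqT hte) v
    refine (hres δ).trans ?_
    rw [← h2]
    exact sub_self _
  · intro h1
    refine hder.congr_deriv ?_
    ext δ
    have h2 := hres δ
    rw [h1] at h2
    exact (sub_eq_zero.1 h2.symm).symm

theorem herglotzEquations_iff_eulerPoincareHerglotz [FiniteDimensional ℝ E] (hh : 0 < h)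
    (hL : ContMDiff (I.tangent.prod 𝓘(ℝ, ℝ)) 𝓘(ℝ, ℝ) ∞ L) (hinv : LeftInvariant I L)
    (hg : ContMDiffOn 𝓘(ℝ, ℝ) I ∞ g (Icc 0 h)) (hz : ContDiffOn ℝ ∞ z (Icc 0 h)) :
    HerglotzEquations I L h g z ↔
      EulerPoincareHerglotz I (reducedLagrangian I L) h (bodyVelocity I h g) z := by
  have : CompleteSpace E := FiniteDimensional.complete ℝ E
  have hl := contDiff_reducedLagrangian hL
  have hξ := contDiffOn_bodyVelocity hh hg
  refine Iff.trans ?_ (eulerPoincareHerglotz_iff (E := E) hh hl hξ hz).symm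
  refine and_congr ⟨fun h1 t ht => ?_, fun h1 e he t ht hte => ?_⟩ (actionEquation_iff hinv h g z)
  -- One chart around `g t` suffices in this direction.
  · exact (herglotzEquation_iff_ephResidual hh hL hinv hg hz
      (IsManifold.chart_mem_maximalAtlas (g t)) ht (mem_chart_source H (g t))).1
      (h1 _ (IsManifold.chart_mem_maximalAtlas (g t)) t ht (mem_chart_source H (g t)))
  · exact (herglotzEquation_iff_ephResidual hh hL hinv hg hz he ht hte).2 (h1 t ht)

end Charts

end Herglotz

end

theorem mainTheorem1
    {E : Type*} [NormedAddCommGroup E] [NormedSpace ℝ E] [FiniteDimensional ℝ E]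
    {H : Type*} [TopologicalSpace H] (I : ModelWithCorners ℝ E H) [I.Boundaryless]
    {G : Type*} [TopologicalSpace G] [ChartedSpace H G] [Group G] [LieGroup I ∞ G]
    (L : TangentBundle I G × ℝ → ℝ)
    (hL : ContMDiff (I.tangent.prod 𝓘(ℝ, ℝ)) 𝓘(ℝ, ℝ) ∞ L)
    (hinv : Herglotz.LeftInvariant I L)
    (h : ℝ) (hh : 0 < h)
    (g : ℝ → G) (hg : ContMDiffOn 𝓘(ℝ, ℝ) I ∞ g (Icc 0 h))
    (z : ℝ → ℝ) (hz : ContDiffOn ℝ ∞ z (Icc 0 h)) :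
    List.TFAE
      [Herglotz.HerglotzEquations I L h g z,
       Herglotz.HerglotzPrinciple I L h g z,
       Herglotz.EulerPoincareHerglotz I (Herglotz.reducedLagrangian I L) h
         (Herglotz.bodyVelocity I h g) z,
       Herglotz.ReducedHerglotzPrinciple I (Herglotz.reducedLagrangian I L) h
         (Herglotz.bodyVelocity I h g) z] := by
  tfae_have 1 ↔ 3 := Herglotz.herglotzEquations_iff_eulerPoincareHerglotz hh hL hinv hg hz
  tfae_have 3 → 4 := Herglotz.reducedHerglotzPrinciple_of_eulerPoincareHerglotz hh hL hg hz
  tfae_have 4 → 2 := Herglotz.herglotzPrinciple_of_reducedHerglotzPrinciple hh hinv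
  tfae_have 2 → 3 := Herglotz.eulerPoincareHerglotz_of_herglotzPrinciple hh hL hinv hg hz
  tfae_finish
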